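/- **Definitions.** For $\theta\in\mathbb R$ let $A_\theta$ be the algebra of smooth functions on the noncommutative torus $T_\theta$: the series $\sum a_{n_1,n_2}U_1^{n_1}U_2^{n_2}$ with rapidly decreasing coefficients $a_{n_1,n_2}\in\mathbb C$, where $U_1U_2=e^{2\pi i\theta}U_2U_1$. For $\tau\in\mathbb C$ with $\operatorname{Im}\tau<0$ let $\delta_\tau$ be the derivation of $A_\theta$ with $\delta_\tau(U_1)=2\pi i\tau U_1$, $\delta_\tau(U_2)=2\pi i\,U_2$. Let $g=\begin{pmatrix}a&b\\c&d\end{pmatrix}\in \mathrm{SL}_2(\mathbb Z)$ have real positive eigenvalues and $c>0$, let $r$ be one of its eigenvalues, and put $\theta=(r-d)/c$, so that $r=c\theta+d$ and $g\theta=\theta$. The basic $A_\theta$-$A_\theta$-bimodule $E=E_g(\theta)$ is the Schwartz space $\mathcal S(\mathbb R\times\mathbb Z/c\mathbb Z)$ with $$(fU_1)(x,\alpha)=f(x-\tfrac rc,\alpha-1),\qquad (fU_2)(x,\alpha)=e^{2\pi i(x-\alpha d/c)}f(x,\alpha),$$ $$(U_1f)(x,\alpha)=f(x-\tfrac1c,\alpha-a),\qquad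 (U_2f)(x,\alpha)=e^{2\pi i(x/r-\alpha/c)}f(x,\alpha).$$ Its standard holomorphic structure is $\overline\nabla_0 f=\partial f/\partial x+2\pi i\tau\frac cr\,x f$; it satisfies $\overline\nabla_0(fu)=\overline\nabla_0(f)u+f\delta_\tau(u)$ and $\overline\nabla_0(uf)=u\overline\nabla_0(f)+r^{-1}\delta_\tau(u)f$ for $u\in A_\theta$. Equip $E^{\otimes 0}=A_\theta$ with $\delta_\tau$ and $E^{\otimes (n+1)}=E^{\otimes n}\otimes_{A_\theta}E$ with $\overline\nabla(y\otimes e)=r^{-1}\overline\nabla(y)\otimes e+y\otimes\overline\nabla_0(e)$. The space $H^0(T_{\theta,\tau},E^{\otimes n})$ of holomorphic vectors is the kernel of $\overline\nabla$ on $E^{\otimes n}$, and $$B_{g,r}(\tau)=\bigoplus_{n\ge 0}H^0(T_{\theta,\tau},E^{\otimes n})$$ is the graded $\mathbb C$-algebra whose product is the tensor product of holomorphic vectors. **Proposition.** Let $g=\begin{pmatrix}a&b\\c&d\end{pmatrix}\in \mathrm{SL}_2(\mathbb Z)$ have real positive eigenvalues and $c>0$, let $r$ be an eigenvalue of $g$,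 and let $\tau\in\mathbb C$ with $\operatorname{Im}\tau<0$. Put $g'=\begin{pmatrix}d&b\\c&a\end{pmatrix}$ (which again has real positive eigenvalues, $r^{-1}$ among them, and lower left entry $c>0$). Then there is an isomorphism of graded $\mathbb C$-algebras $$B_{g,r}(\tau)^{opp}\simeq B_{g',r^{-1}}(\tau).$$ -/

import Mathlib

/-! ### Holomorphic modules over an algebra with a derivation -/

section Holomorphic

open TensorProduct MulOpposite

/-- A right module over a complex algebra `A` endowed with a derivation `δ`, together with a
holomorphic structure: a `ℂ`-linear operator `nabla` with `∇(e a) = ∇(e) a + e δ(a)`.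
Right `A`-modules are written as modules over the opposite ring, `e a` being `op a • e`. -/
structure HolModule (A : Type) [Ring A] [Algebra ℂ A] (δ : A →ₗ[ℂ] A) where
  carrier : Type
  [addCommGroup : AddCommGroup carrier]
  [moduleC : Module ℂ carrier]
  [moduleA : Module Aᵐᵒᵖ carrier]
  [tower : IsScalarTower ℂ Aᵐᵒᵖ carrier]
  nabla : carrier →ₗ[ℂ] carrier
  leibniz : ∀ (e : carrier) (a : A), nabla (op a • e) = op a • nabla e + op (δ a) • e

attribute [instance] HolModule.addCommGroup HolModule.moduleC HolModule.moduleA HolModule.tower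

/-- An `A`-`A`-bimodule of rank `rk` whose underlying right module has a holomorphic structure which
is compatible with the left action: `∇(a e) = a ∇(e) + rk⁻¹ δ(a) e`. -/
structure HolBimodule (A : Type) [Ring A] [Algebra ℂ A] (δ : A →ₗ[ℂ] A) extends
    HolModule A δ where
  [moduleL : Module A carrier]
  [towerL : IsScalarTower ℂ A carrier]
  [comm : SMulCommClass A Aᵐᵒᵖ carrier]
  rk : ℝ
  leibniz_left : ∀ (a : A) (e : carrier),
    nabla (a • e) = a • nabla e + (rk : ℂ)⁻¹ • (δ a • e)

attribute [instance] HolBimodule.moduleL HolBimodule.towerL HolBimodule.comm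

variable {A : Type} [Ring A] [Algebra ℂ A] {δ : A →ₗ[ℂ] A}

/-- The space `H⁰` of holomorphic vectors: the kernel of the holomorphic structure. -/
def HolModule.H0 (M : HolModule A δ) : Submodule ℂ M.carrier := LinearMap.ker M.nabla

/-- The relations `m a ⊗ e = m ⊗ a e`. -/
def balancedRel (M : HolModule A δ) (E : HolBimodule A δ) :
    Submodule ℂ (M.carrier ⊗[ℂ] E.carrier) :=
  Submodule.span ℂ {t | ∃ (m : M.carrier) (a : A) (e : E.carrier),
    t = (op a • m) ⊗ₜ[ℂ] e - m ⊗ₜ[ℂ] (a • e)}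

/-- The tensor product `M ⊗_A E` of a right `A`-module and an `A`-`A`-bimodule. -/
def TensorOver (M : HolModule A δ) (E : HolBimodule A δ) : Type :=
  (M.carrier ⊗[ℂ] E.carrier) ⧸ balancedRel M E

namespace TensorOver

variable {M N : HolModule A δ} {E : HolBimodule A δ}

noncomputable instance : AddCommGroup (TensorOver M E) :=
  inferInstanceAs (AddCommGroup ((M.carrier ⊗[ℂ] E.carrier) ⧸ balancedRel M E))

noncomputable instance : Module ℂ (TensorOver M E) :=
  inferInstanceAs (Module ℂ ((M.carrier ⊗[ℂ] E.carrier) ⧸ balancedRel M E))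

/-- The class of `m ⊗ e` in `M ⊗_A E`. -/
noncomputable def tmul (m : M.carrier) (e : E.carrier) : TensorOver M E :=
  (balancedRel M E).mkQ (m ⊗ₜ[ℂ] e)

theorem tmul_balanced (m : M.carrier) (a : A) (e : E.carrier) :
    tmul (op a • m) e = tmul m (a • e) := by
  have h : (op a • m) ⊗ₜ[ℂ] e - m ⊗ₜ[ℂ] (a • e) ∈ balancedRel M E :=
    Submodule.subset_span ⟨m, a, e, rfl⟩
  exact (Submodule.Quotient.eq _).2 h

theorem tmul_add (m : M.carrier) (e e' : E.carrier) :
    tmul m (e + e') = tmul m e + tmul m e' := by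
  simp only [tmul, TensorProduct.tmul_add, map_add]; rfl

theorem add_tmul (m m' : M.carrier) (e : E.carrier) :
    tmul (m + m') e = tmul m e + tmul m' e := by
  simp only [tmul, TensorProduct.add_tmul, map_add]; rfl

theorem smul_tmul (z : ℂ) (m : M.carrier) (e : E.carrier) :
    tmul (z • m) e = z • tmul m e := by
  simp only [tmul, ← TensorProduct.smul_tmul', map_smul]; rfl

theorem tmul_smul (z : ℂ) (m : M.carrier) (e : E.carrier) :
    tmul m (z • e) = z • tmul m e := by
  simp only [tmul, TensorProduct.tmul_smul, map_smul]; rfl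

theorem zero_tmul (e : E.carrier) : tmul (0 : M.carrier) e = 0 := by
  simp only [tmul, TensorProduct.zero_tmul, map_zero]; rfl

theorem tmul_zero (m : M.carrier) : tmul m (0 : E.carrier) = 0 := by
  simp only [tmul, TensorProduct.tmul_zero, map_zero]; rfl

theorem induction {p : TensorOver M E → Prop} (h0 : p 0) (ht : ∀ m e, p (tmul m e))
    (ha : ∀ x y, p x → p y → p (x + y)) (x : TensorOver M E) : p x := by
  obtain ⟨t, rfl⟩ := (balancedRel M E).mkQ_surjective x
  induction t using TensorProduct.induction_on with
  | zero => exact h0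
  | tmul m e => exact ht m e
  | add x y hx hy => exact ha _ _ hx hy

/-- A `ℂ`-bilinear map `φ` with `φ (m a) e = φ m (a e)` factors through `M ⊗_A E`. -/
noncomputable def lift {V : Type} [AddCommGroup V] [Module ℂ V]
    (φ : M.carrier →ₗ[ℂ] E.carrier →ₗ[ℂ] V)
    (h : ∀ (m : M.carrier) (a : A) (e : E.carrier), φ (op a • m) e = φ m (a • e)) :
    TensorOver M E →ₗ[ℂ] V :=
  (balancedRel M E).liftQ (TensorProduct.lift φ) (by
    rw [balancedRel, Submodule.span_le]
    rintro _ ⟨m, a, e, rfl⟩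
    simp [h])

theorem lift_tmul {V : Type} [AddCommGroup V] [Module ℂ V]
    (φ : M.carrier →ₗ[ℂ] E.carrier →ₗ[ℂ] V)
    (h : ∀ (m : M.carrier) (a : A) (e : E.carrier), φ (op a • m) e = φ m (a • e))
    (m : M.carrier) (e : E.carrier) : lift φ h (tmul m e) = φ m e := by
  have := Submodule.liftQ_apply (balancedRel M E) (TensorProduct.lift φ) (m ⊗ₜ[ℂ] e)
    (h := by
      rw [balancedRel, Submodule.span_le]
      rintro _ ⟨m, a, e, rfl⟩
      simp [h])
  exact this.trans (by simp)

/-- The canonical bilinear map `M × E → M ⊗_A E`. -/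
noncomputable def mk : M.carrier →ₗ[ℂ] E.carrier →ₗ[ℂ] TensorOver M E :=
  LinearMap.mk₂ ℂ tmul add_tmul smul_tmul tmul_add tmul_smul

@[simp] theorem mk_apply (m : M.carrier) (e : E.carrier) : mk m e = tmul m e := rfl

/-- Right multiplication by `a` on a right module. -/
noncomputable def rmul (M : HolModule A δ) (a : Aᵐᵒᵖ) : M.carrier →ₗ[ℂ] M.carrier where
  toFun e := a • e
  map_add' := smul_add a
  map_smul' z e := smul_comm a z e

/-- The right action `(m ⊗ e) a = m ⊗ e a`. -/
noncomputable def act (a : Aᵐᵒᵖ) : TensorOver M E →ₗ[ℂ] TensorOver M E :=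
  lift ((mk (M := M) (E := E)).compl₂ (rmul E.toHolModule a)) (by
    intro m b e
    simp only [LinearMap.compl₂_apply, mk_apply, rmul, LinearMap.coe_mk, AddHom.coe_mk]
    rw [tmul_balanced, smul_comm])

theorem act_tmul (a : Aᵐᵒᵖ) (m : M.carrier) (e : E.carrier) :
    act a (tmul m e) = tmul m (a • e) := lift_tmul _ _ _ _

noncomputable instance : Module Aᵐᵒᵖ (TensorOver M E) where
  smul a x := act a x
  one_smul x := by
    change act 1 x = x
    induction x using induction with
    | h0 => simp
    | ht m e => rw [act_tmul, one_smul]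
    | ha x y hx hy => rw [map_add, hx, hy]
  mul_smul a b x := by
    change act (a * b) x = act a (act b x)
    induction x using induction with
    | h0 => simp
    | ht m e => rw [act_tmul, act_tmul, act_tmul, mul_smul]
    | ha x y hx hy => simp only [map_add, hx, hy]
  smul_zero a := map_zero (act a)
  smul_add a := map_add (act a)
  add_smul a b x := by
    change act (a + b) x = act a x + act b x
    induction x using induction with
    | h0 => simp
    | ht m e => rw [act_tmul, act_tmul, act_tmul, add_smul, tmul_add]
    | ha x y hx hy => simp only [map_add, hx, hy]; abel
  zero_smul x := by
    change act 0 x = 0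
    induction x using induction with
    | h0 => simp
    | ht m e => rw [act_tmul, zero_smul, tmul_zero]
    | ha x y hx hy => rw [map_add, hx, hy, add_zero]

theorem op_smul_tmul (a : Aᵐᵒᵖ) (m : M.carrier) (e : E.carrier) :
    a • (tmul m e : TensorOver M E) = tmul m (a • e) := act_tmul a m e

instance : IsScalarTower ℂ Aᵐᵒᵖ (TensorOver M E) where
  smul_assoc z a x := by
    induction x using induction with
    | h0 => simp
    | ht m e => rw [op_smul_tmul, op_smul_tmul, smul_assoc, tmul_smul]
    | ha x y hx hy => simp only [smul_add, hx, hy]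

/-- The tensor product holomorphic structure
`∇(m ⊗ e) = rk(E)⁻¹ ∇(m) ⊗ e + m ⊗ ∇(e)` on `M ⊗_A E`. -/
noncomputable def nabla : TensorOver M E →ₗ[ℂ] TensorOver M E :=
  lift ((E.rk : ℂ)⁻¹ • (mk (M := M) (E := E)).comp M.nabla + (mk (M := M) (E := E)).compl₂ E.nabla)
    (by
      intro m a e
      simp only [LinearMap.add_apply, LinearMap.smul_apply, LinearMap.comp_apply,
        LinearMap.compl₂_apply, mk_apply]
      rw [M.leibniz, E.leibniz_left, add_tmul, tmul_add, tmul_balanced, tmul_balanced,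
        tmul_balanced, tmul_smul, smul_add]
      abel)

theorem nabla_tmul (m : M.carrier) (e : E.carrier) :
    nabla (tmul m e : TensorOver M E) = (E.rk : ℂ)⁻¹ • tmul (M.nabla m) e + tmul m (E.nabla e) :=
  lift_tmul _ _ _ _

theorem nabla_leibniz (x : TensorOver M E) (a : A) :
    nabla (op a • x) = op a • nabla x + op (δ a) • x := by
  induction x using induction with
  | h0 => simp
  | ht m e =>
    rw [op_smul_tmul, nabla_tmul, nabla_tmul, E.leibniz, tmul_add, smul_add, op_smul_tmul,
      op_smul_tmul, smul_comm, op_smul_tmul]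
    abel
  | ha x y hx hy => simp only [smul_add, map_add, hx, hy]; abel

/-- The functor `- ⊗_A E` on right `A`-linear maps: `f ⊗ id`. -/
noncomputable def map (E : HolBimodule A δ) (f : M.carrier →ₗ[Aᵐᵒᵖ] N.carrier) :
    TensorOver M E →ₗ[Aᵐᵒᵖ] TensorOver N E :=
  let F : TensorOver M E →ₗ[ℂ] TensorOver N E :=
    lift ((mk (M := N) (E := E)).comp (f.restrictScalars ℂ)) (by
      intro m a e
      simp only [LinearMap.comp_apply, mk_apply, LinearMap.coe_restrictScalars]
      rw [map_smul, tmul_balanced])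
  { toFun := F
    map_add' := F.map_add
    map_smul' := by
      intro a x
      simp only [RingHom.id_apply]
      induction x using induction with
      | h0 => simp
      | ht m e =>
        rw [op_smul_tmul, lift_tmul, lift_tmul]
        exact (op_smul_tmul a (f m) e).symm
      | ha x y hx hy => rw [smul_add, F.map_add, hx, hy, F.map_add, smul_add] }

theorem map_tmul (f : M.carrier →ₗ[Aᵐᵒᵖ] N.carrier) (m : M.carrier) (e : E.carrier) :
    map E f (tmul m e) = tmul (f m) e := by
  refine lift_tmul ((mk (M := N) (E := E)).comp (f.restrictScalars ℂ)) ?_ _ _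
  intro m a e
  simp only [LinearMap.comp_apply, mk_apply, LinearMap.coe_restrictScalars]
  rw [map_smul, tmul_balanced]

end TensorOver

/-- The holomorphic module `M ⊗_A E`. -/
noncomputable def HolModule.tensor (M : HolModule A δ) (E : HolBimodule A δ) : HolModule A δ where
  carrier := TensorOver M E
  nabla := TensorOver.nabla
  leibniz := TensorOver.nabla_leibniz

/-- The derivation property. -/
def IsDeriv (δ : A →ₗ[ℂ] A) : Prop := ∀ a b : A, δ (a * b) = δ a * b + a * δ b

theorem IsDeriv.map_one (h : IsDeriv δ) : δ 1 = 0 := by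
  have h1 := h 1 1
  rw [mul_one, mul_one, one_mul] at h1
  simpa using h1

/-- The free right module `A` with the holomorphic structure `δ`. -/
def HolModule.unit (hδ : IsDeriv δ) : HolModule A δ where
  carrier := A
  nabla := δ
  leibniz e a := by
    simp only [op_smul_eq_mul]
    exact hδ e a

namespace HolBimodule

variable (E : HolBimodule A δ) (hδ : IsDeriv δ)

/-- The tensor powers `E^{⊗ n} = E ⊗_A ⋯ ⊗_A E` with their induced holomorphic structures, where
`E^{⊗ 0} = A` has the holomorphic structure `δ`. -/
noncomputable def pow : ℕ → HolModule A δ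
  | 0 => HolModule.unit hδ
  | n + 1 => (pow n).tensor E

/-- The tensor product map `E^{⊗ m} × E^{⊗ n} → E^{⊗ (m + n)}`, for a fixed left factor `x`: it is
`a ↦ x a` for `n = 0`, and `y ⊗ e ↦ (x ⊗ y) ⊗ e` in general. -/
noncomputable def mulLeft {m : ℕ} (x : (E.pow hδ m).carrier) :
    (n : ℕ) → (E.pow hδ n).carrier →ₗ[Aᵐᵒᵖ] (E.pow hδ (m + n)).carrier
  | 0 =>
    { toFun := fun a : A => op a • x
      map_add' := fun a b => by rw [← add_smul]; rfl
      map_smul' := fun a b => by simp only [RingHom.id_apply, ← mul_smul]; rfl }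
  | n + 1 => TensorOver.map E (mulLeft x n)

/-- The element `y ⊗ e` of `E^{⊗ (n + 1)}`. -/
noncomputable def snoc {n : ℕ} (y : (E.pow hδ n).carrier) (e : E.carrier) :
    (E.pow hδ (n + 1)).carrier :=
  (TensorOver.tmul y e : TensorOver (E.pow hδ n) E)

theorem pow_induction {n : ℕ} {p : (E.pow hδ (n + 1)).carrier → Prop} (h0 : p 0)
    (ht : ∀ y e, p (E.snoc hδ y e)) (ha : ∀ x y, p x → p y → p (x + y))
    (x : (E.pow hδ (n + 1)).carrier) : p x :=
  TensorOver.induction (p := p) h0 ht ha x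

theorem snoc_add_left {n : ℕ} (y y' : (E.pow hδ n).carrier) (e : E.carrier) :
    E.snoc hδ (y + y') e = E.snoc hδ y e + E.snoc hδ y' e := TensorOver.add_tmul _ _ _

theorem snoc_smul_left {n : ℕ} (z : ℂ) (y : (E.pow hδ n).carrier) (e : E.carrier) :
    E.snoc hδ (z • y) e = z • E.snoc hδ y e := TensorOver.smul_tmul _ _ _

theorem nabla_snoc {n : ℕ} (y : (E.pow hδ n).carrier) (e : E.carrier) :
    (E.pow hδ (n + 1)).nabla (E.snoc hδ y e) =
      (E.rk : ℂ)⁻¹ • E.snoc hδ ((E.pow hδ n).nabla y) e + E.snoc hδ y (E.nabla e) :=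
  TensorOver.nabla_tmul _ _

theorem mulLeft_zero {m : ℕ} (x : (E.pow hδ m).carrier) (a : A) :
    E.mulLeft hδ x 0 a = op a • x := rfl

theorem mulLeft_snoc {m n : ℕ} (x : (E.pow hδ m).carrier) (y : (E.pow hδ n).carrier)
    (e : E.carrier) :
    E.mulLeft hδ x (n + 1) (E.snoc hδ y e) = E.snoc hδ (E.mulLeft hδ x n y) e :=
  TensorOver.map_tmul _ _ _

theorem mulLeft_add {m n : ℕ} (x x' : (E.pow hδ m).carrier) (y : (E.pow hδ n).carrier) :
    E.mulLeft hδ (x + x') n y = E.mulLeft hδ x n y + E.mulLeft hδ x' n y := by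
  induction n with
  | zero => exact smul_add _ _ _
  | succ n ih =>
    induction y using pow_induction with
    | h0 => simp
    | ht y e => rw [mulLeft_snoc, mulLeft_snoc, mulLeft_snoc, ih, snoc_add_left]
    | ha y y' hy hy' => rw [map_add, hy, hy', map_add, map_add]; abel

theorem mulLeft_smul {m n : ℕ} (z : ℂ) (x : (E.pow hδ m).carrier) (y : (E.pow hδ n).carrier) :
    E.mulLeft hδ (z • x) n y = z • E.mulLeft hδ x n y := by
  induction n with
  | zero => exact smul_comm _ _ _
  | succ n ih =>
    induction y using pow_induction with
    | h0 => simp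
    | ht y e => rw [mulLeft_snoc, mulLeft_snoc, ih, snoc_smul_left]
    | ha y y' hy hy' => rw [map_add, hy, hy', map_add, smul_add]

theorem mulLeft_zero_left {m n : ℕ} (y : (E.pow hδ n).carrier) :
    E.mulLeft hδ (0 : (E.pow hδ m).carrier) n y = 0 := by
  have := E.mulLeft_smul hδ (0 : ℂ) (0 : (E.pow hδ m).carrier) y
  rwa [zero_smul, zero_smul] at this

theorem nabla_mulLeft {m n : ℕ} (x : (E.pow hδ m).carrier) (y : (E.pow hδ n).carrier) :
    (E.pow hδ (m + n)).nabla (E.mulLeft hδ x n y) =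
      (E.rk : ℂ)⁻¹ ^ n • E.mulLeft hδ ((E.pow hδ m).nabla x) n y +
        E.mulLeft hδ x n ((E.pow hδ n).nabla y) := by
  induction n with
  | zero =>
    rw [pow_zero, one_smul]
    exact (E.pow hδ m).leibniz x y
  | succ n ih =>
    induction y using pow_induction with
    | h0 => simp
    | ht y e =>
      rw [mulLeft_snoc, mulLeft_snoc]
      refine (E.nabla_snoc hδ (n := m + n) _ _).trans ?_
      rw [nabla_snoc, ih, map_add, LinearMap.map_smul_of_tower, mulLeft_snoc, mulLeft_snoc,
        snoc_add_left, snoc_smul_left, smul_add, smul_smul, pow_succ']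
      exact add_assoc _ _ _
    | ha y y' hy hy' =>
      rw [map_add, map_add, hy, hy', map_add, map_add, map_add, smul_add]
      abel

/-- The identification of `E^{⊗ m}` and `E^{⊗ n}` for `m = n`. -/
noncomputable def castPow {m n : ℕ} (h : m = n) (x : (E.pow hδ m).carrier) :
    (E.pow hδ n).carrier := h ▸ x

theorem castPow_zero {m n : ℕ} (h : m = n) : E.castPow hδ h 0 = 0 := by
  subst h; rfl

theorem castPow_add {m n : ℕ} (h : m = n) (x y : (E.pow hδ m).carrier) :
    E.castPow hδ h (x + y) = E.castPow hδ h x + E.castPow hδ h y := by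
  subst h; rfl

theorem castPow_snoc {m n : ℕ} (h : m = n) (h' : m + 1 = n + 1) (x : (E.pow hδ m).carrier)
    (e : E.carrier) :
    E.castPow hδ h' (E.snoc hδ x e) = E.snoc hδ (E.castPow hδ h x) e := by
  subst h; rfl

/-- The unit `1 ∈ A = E^{⊗ 0}`. -/
def powOne : (E.pow hδ 0).carrier := (1 : A)

theorem mulLeft_powOne {m : ℕ} (x : (E.pow hδ m).carrier) :
    E.mulLeft hδ x 0 (E.powOne hδ) = x := by
  change (op (1 : A)) • x = x
  rw [op_one, one_smul]

theorem powOne_mulLeft {n : ℕ} (y : (E.pow hδ n).carrier) :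
    E.castPow hδ (zero_add n) (E.mulLeft hδ (E.powOne hδ) n y) = y := by
  induction n with
  | zero => exact one_mul (M := A) y
  | succ n ih =>
    induction y using pow_induction with
    | h0 => rw [map_zero, castPow_zero]
    | ht y e =>
      rw [mulLeft_snoc]
      refine (E.castPow_snoc hδ (zero_add n) _ _ _).trans ?_
      rw [ih]
    | ha y y' hy hy' => rw [map_add, castPow_add, hy, hy']

theorem mulLeft_smul_right {m n : ℕ} (z : ℂ) (x : (E.pow hδ m).carrier)
    (y : (E.pow hδ n).carrier) : E.mulLeft hδ x n (z • y) = z • E.mulLeft hδ x n y :=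
  LinearMap.map_smul_of_tower _ _ _

theorem mulLeft_assoc {m n p : ℕ} (x : (E.pow hδ m).carrier) (y : (E.pow hδ n).carrier)
    (w : (E.pow hδ p).carrier) :
    E.castPow hδ (add_assoc m n p) (E.mulLeft hδ (E.mulLeft hδ x n y) p w) =
      E.mulLeft hδ x (n + p) (E.mulLeft hδ y p w) := by
  induction p with
  | zero => exact ((E.mulLeft hδ x n).map_smul (op (w : A)) y).symm
  | succ p ih =>
    induction w using pow_induction with
    | h0 => simp only [map_zero]; exact E.castPow_zero hδ _
    | ht w e =>
      rw [mulLeft_snoc, mulLeft_snoc]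
      refine (E.castPow_snoc hδ (add_assoc m n p) _ _ _).trans ?_
      rw [ih]
      exact (E.mulLeft_snoc hδ x (E.mulLeft hδ y p w) e).symm
    | ha w w' hw hw' => rw [map_add, castPow_add, hw, hw', map_add, map_add]

/-- The graded pieces `H⁰(E^{⊗ n})` of the homogeneous coordinate algebra. -/
abbrev piece (n : ℕ) : Type := (E.pow hδ n).H0

theorem mk_eq {m n : ℕ} (h : m = n) {x : E.piece hδ m} {y : E.piece hδ n}
    (hxy : E.castPow hδ h x.1 = y.1) :
    (GradedMonoid.mk m x : GradedMonoid (E.piece hδ)) = GradedMonoid.mk n y := by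
  subst h
  exact congrArg _ (Subtype.ext hxy)

theorem mul_mem {m n : ℕ} (x : E.piece hδ m) (y : E.piece hδ n) :
    E.mulLeft hδ x.1 n y.1 ∈ (E.pow hδ (m + n)).H0 := by
  have hx : (E.pow hδ m).nabla x.1 = 0 := x.2
  have hy : (E.pow hδ n).nabla y.1 = 0 := y.2
  change (E.pow hδ (m + n)).nabla _ = 0
  rw [nabla_mulLeft, hx, hy, mulLeft_zero_left, smul_zero, map_zero, add_zero]

theorem one_mem : E.powOne hδ ∈ (E.pow hδ 0).H0 := by
  have h : δ (1 : A) = 0 := hδ.map_one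
  exact h

/-- The product of holomorphic vectors is their tensor product. -/
noncomputable instance : GradedMonoid.GMul (E.piece hδ) where
  mul {_ n} x y := ⟨E.mulLeft hδ x.1 n y.1, E.mul_mem hδ x y⟩

noncomputable instance : GradedMonoid.GOne (E.piece hδ) where
  one := ⟨E.powOne hδ, E.one_mem hδ⟩

noncomputable instance : DirectSum.GSemiring (E.piece hδ) where
  mul_zero x := Subtype.ext (map_zero _)
  zero_mul y := Subtype.ext (E.mulLeft_zero_left hδ y.1)
  mul_add x y y' := Subtype.ext (map_add _ _ _)
  add_mul x x' y := Subtype.ext (E.mulLeft_add hδ _ _ _)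
  one_mul y := E.mk_eq hδ (zero_add _) (E.powOne_mulLeft hδ y.2.1)
  mul_one x := E.mk_eq hδ (add_zero _) (E.mulLeft_powOne hδ x.2.1)
  mul_assoc x y w := E.mk_eq hδ (add_assoc _ _ _) (E.mulLeft_assoc hδ x.2.1 y.2.1 w.2.1)
  natCast n := n • GradedMonoid.GOne.one
  natCast_zero := zero_smul _ _
  natCast_succ n := by rw [add_smul, one_smul]

noncomputable instance : DirectSum.GAlgebra ℂ (E.piece hδ) where
  toFun :=
    { toFun := fun z => z • GradedMonoid.GOne.one
      map_zero' := zero_smul _ _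
      map_add' := fun z w => add_smul z w _ }
  map_one := one_smul _ _
  map_mul z w := by
    refine E.mk_eq hδ (add_zero 0).symm ?_
    change (z * w) • E.powOne hδ = E.mulLeft hδ (z • E.powOne hδ) 0 (w • E.powOne hδ)
    rw [mulLeft_smul_right, mulLeft_powOne, mul_comm, mul_smul]
  commutes z x := by
    refine E.mk_eq hδ ((zero_add _).trans (add_zero _).symm) ?_
    change E.castPow hδ _ (E.mulLeft hδ (z • E.powOne hδ) x.1 x.2.1) =
      E.mulLeft hδ x.2.1 0 (z • E.powOne hδ)
    rw [mulLeft_smul_right, mulLeft_powOne, mulLeft_smul, ← mulLeft_smul_right]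
    exact E.powOne_mulLeft hδ _
  smul_def z x := by
    refine (E.mk_eq hδ (zero_add _) ?_).symm
    change E.castPow hδ _ (E.mulLeft hδ (z • E.powOne hδ) x.1 x.2.1) = z • x.2.1
    rw [mulLeft_smul, ← mulLeft_smul_right]
    exact E.powOne_mulLeft hδ _

/-- The homogeneous coordinate algebra `B_E = ⨁_{n ≥ 0} H⁰(E^{⊗ n})`. -/
abbrev coordAlgebra : Type := DirectSum ℕ (E.piece hδ)

end HolBimodule

end Holomorphic
/-! ### The algebra of smooth functions on a noncommutative torus -/

section NCTorusAlgebra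

open Complex

/-- `ex x = exp (2 π i x)`. -/
noncomputable def ex (x : ℝ) : ℂ := Complex.exp (2 * Real.pi * I * x)

theorem ex_add (x y : ℝ) : ex (x + y) = ex x * ex y := by
  rw [ex, ex, ex, ← Complex.exp_add]; congr 1; push_cast; ring

theorem ex_zero : ex 0 = 1 := by simp [ex]

theorem norm_ex (x : ℝ) : ‖ex x‖ = 1 := by
  rw [ex, Complex.norm_exp]; simp

theorem ex_intCast (k : ℤ) : ex k = 1 := by
  rw [ex, Complex.exp_eq_one_iff]; exact ⟨k, by push_cast; ring⟩

theorem ex_zpow (x : ℝ) (k : ℤ) : ex x ^ k = ex (k * x) := by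
  rw [ex, ex, ← Complex.exp_int_mul]; congr 1; push_cast; ring

theorem ex_ne_zero (x : ℝ) : ex x ≠ 0 := Complex.exp_ne_zero _

/-- The weight `1 + |n₁| + |n₂|` on `ℤ²`. -/
noncomputable def wt (n : ℤ × ℤ) : ℝ := 1 + |(n.1 : ℝ)| + |(n.2 : ℝ)|

theorem one_le_wt (n : ℤ × ℤ) : 1 ≤ wt n := by
  have h1 := abs_nonneg (n.1 : ℝ)
  have h2 := abs_nonneg (n.2 : ℝ)
  rw [wt]; linarith

theorem wt_pos (n : ℤ × ℤ) : 0 < wt n := lt_of_lt_of_le one_pos (one_le_wt n)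

theorem wt_add_le (m n : ℤ × ℤ) : wt (m + n) ≤ wt m * wt n := by
  have h1 := abs_add_le (m.1 : ℝ) n.1
  have h2 := abs_add_le (m.2 : ℝ) n.2
  simp only [wt, Prod.fst_add, Prod.snd_add, Int.cast_add]
  nlinarith [mul_nonneg (abs_nonneg (m.1 : ℝ)) (abs_nonneg (n.1 : ℝ)),
    mul_nonneg (abs_nonneg (m.1 : ℝ)) (abs_nonneg (n.2 : ℝ)),
    mul_nonneg (abs_nonneg (m.2 : ℝ)) (abs_nonneg (n.1 : ℝ)),
    mul_nonneg (abs_nonneg (m.2 : ℝ)) (abs_nonneg (n.2 : ℝ))]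

/-- The rapidly decreasing functions on `ℤ²`. -/
def rapid : Submodule ℂ (ℤ × ℤ → ℂ) where
  carrier := {a | ∀ k : ℕ, ∃ C : ℝ, ∀ n, wt n ^ k * ‖a n‖ ≤ C}
  zero_mem' k := ⟨0, fun n => by simp⟩
  add_mem' {a b} ha hb k := by
    obtain ⟨C, hC⟩ := ha k
    obtain ⟨D, hD⟩ := hb k
    refine ⟨C + D, fun n => ?_⟩
    calc wt n ^ k * ‖a n + b n‖ ≤ wt n ^ k * (‖a n‖ + ‖b n‖) :=
          mul_le_mul_of_nonneg_left (norm_add_le _ _) (pow_nonneg (wt_pos n).le k)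
      _ ≤ C + D := by rw [mul_add]; exact add_le_add (hC n) (hD n)
  smul_mem' z a ha k := by
    obtain ⟨C, hC⟩ := ha k
    refine ⟨‖z‖ * C, fun n => ?_⟩
    calc wt n ^ k * ‖z * a n‖ = ‖z‖ * (wt n ^ k * ‖a n‖) := by rw [norm_mul]; ring
      _ ≤ ‖z‖ * C := mul_le_mul_of_nonneg_left (hC n) (norm_nonneg z)

theorem summable_inv_wt : Summable fun n : ℤ × ℤ => (wt n ^ 4)⁻¹ := by
  have h1 : Summable fun n : ℤ => ((1 + |(n : ℝ)|) ^ 2)⁻¹ := by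
    have h0 : Summable fun n : ℕ => ((1 + (n : ℝ)) ^ 2)⁻¹ := by
      have := (summable_nat_add_iff 1).2 (Real.summable_nat_pow_inv.2 (one_lt_two))
      refine this.congr fun n => ?_
      push_cast; rw [add_comm]
    refine Summable.of_nat_of_neg ?_ ?_
    · simpa using h0
    · simpa using h0
  have h2 := h1.mul_of_nonneg h1 (fun n => by positivity) (fun n => by positivity)
  refine Summable.of_nonneg_of_le (fun n => by have := wt_pos n; positivity) (fun n => ?_) h2
  rw [← mul_inv]
  refine inv_anti₀ (by positivity) ?_
  have e1 : 1 + |(n.1 : ℝ)| ≤ wt n := by rw [wt]; have := abs_nonneg (n.2 : ℝ); linarith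
  have e2 : 1 + |(n.2 : ℝ)| ≤ wt n := by rw [wt]; have := abs_nonneg (n.1 : ℝ); linarith
  calc (1 + |(n.1 : ℝ)|) ^ 2 * (1 + |(n.2 : ℝ)|) ^ 2 ≤ wt n ^ 2 * wt n ^ 2 := by gcongr
    _ = wt n ^ 4 := by ring

theorem rapid_summable {a : ℤ × ℤ → ℂ} (ha : a ∈ rapid) (k : ℕ) :
    Summable fun n => wt n ^ k * ‖a n‖ := by
  obtain ⟨C, hC⟩ := ha (k + 4)
  refine Summable.of_nonneg_of_le (fun n => by have := wt_pos n; positivity) (fun n => ?_)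
    (summable_inv_wt.mul_left C)
  have h := wt_pos n
  rw [← div_eq_mul_inv, le_div_iff₀ (by positivity)]
  calc wt n ^ k * ‖a n‖ * wt n ^ 4 = wt n ^ (k + 4) * ‖a n‖ := by ring
    _ ≤ C := hC n

theorem rapid_summable_norm {a : ℤ × ℤ → ℂ} (ha : a ∈ rapid) : Summable fun n => ‖a n‖ := by
  simpa using rapid_summable ha 0

theorem rapid_bdd {a : ℤ × ℤ → ℂ} (ha : a ∈ rapid) : ∃ C, ∀ n, ‖a n‖ ≤ C := by
  simpa using ha 0

/-- Multiplication of a rapidly decreasing function by a function of polynomial growth. -/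
theorem rapid_mul {a φ : ℤ × ℤ → ℂ} (ha : a ∈ rapid) (C : ℝ) (j : ℕ)
    (hφ : ∀ n, ‖φ n‖ ≤ C * wt n ^ j) : (fun n => φ n * a n) ∈ rapid := by
  intro k
  obtain ⟨D, hD⟩ := ha (k + j)
  have hC : 0 ≤ C := by
    have h := (norm_nonneg _).trans (hφ 0)
    exact nonneg_of_mul_nonneg_left h (pow_pos (wt_pos 0) j)
  refine ⟨C * D, fun n => ?_⟩
  have h := wt_pos n
  calc wt n ^ k * ‖φ n * a n‖ ≤ wt n ^ k * (C * wt n ^ j * ‖a n‖) := by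
        rw [norm_mul]; gcongr; exact hφ n
    _ = C * (wt n ^ (k + j) * ‖a n‖) := by ring
    _ ≤ C * D := mul_le_mul_of_nonneg_left (hD n) hC

/-- The cocycle defined by `U₁^{m₁} U₂^{m₂} U₁^{k₁} U₂^{k₂} = σ(m, k) U₁^{m₁+k₁} U₂^{m₂+k₂}`, where
`U₁ U₂ = exp (2 π i θ) U₂ U₁`. -/
noncomputable def cocycle (θ : ℝ) (m k : ℤ × ℤ) : ℂ := ex (-(θ * m.2 * k.1))

theorem norm_cocycle (θ : ℝ) (m k : ℤ × ℤ) : ‖cocycle θ m k‖ = 1 := norm_ex _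

/-- Coefficients of the product of two series in `U₁, U₂`. -/
noncomputable def twistedConv (θ : ℝ) (a b : ℤ × ℤ → ℂ) (n : ℤ × ℤ) : ℂ :=
  ∑' m, a m * b (n - m) * cocycle θ m (n - m)

theorem summable_conv (θ : ℝ) {a b : ℤ × ℤ → ℂ} (ha : a ∈ rapid) (hb : b ∈ rapid) (n : ℤ × ℤ) :
    Summable fun m => a m * b (n - m) * cocycle θ m (n - m) := by
  obtain ⟨C, hC⟩ := rapid_bdd hb
  refine Summable.of_norm_bounded ((rapid_summable_norm ha).mul_right C) fun m => ?_
  rw [norm_mul, norm_mul, norm_cocycle, mul_one]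
  exact mul_le_mul_of_nonneg_left (hC _) (norm_nonneg _)

theorem conv_mem (θ : ℝ) {a b : ℤ × ℤ → ℂ} (ha : a ∈ rapid) (hb : b ∈ rapid) :
    twistedConv θ a b ∈ rapid := by
  intro k
  obtain ⟨C, hC⟩ := hb k
  have hs := rapid_summable ha k
  refine ⟨(∑' m, wt m ^ k * ‖a m‖) * C, fun n => ?_⟩
  have hn := pow_pos (wt_pos n) k
  have hsum := (summable_conv θ ha hb n).norm
  calc wt n ^ k * ‖twistedConv θ a b n‖
      ≤ wt n ^ k * ∑' m, ‖a m * b (n - m) * cocycle θ m (n - m)‖ :=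
        mul_le_mul_of_nonneg_left (norm_tsum_le_tsum_norm hsum) hn.le
    _ = ∑' m, wt n ^ k * ‖a m * b (n - m) * cocycle θ m (n - m)‖ := tsum_mul_left.symm
    _ ≤ ∑' m, wt m ^ k * ‖a m‖ * C := by
        refine (hsum.mul_left _).tsum_le_tsum (fun m => ?_) (hs.mul_right C)
        rw [norm_mul, norm_mul, norm_cocycle, mul_one]
        have h1 : wt n ≤ wt m * wt (n - m) := by
          have := wt_add_le m (n - m)
          rwa [add_sub_cancel] at this
        have h2 := wt_pos n
        have h3 := wt_pos m
        calc wt n ^ k * (‖a m‖ * ‖b (n - m)‖)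
            ≤ (wt m * wt (n - m)) ^ k * (‖a m‖ * ‖b (n - m)‖) := by gcongr
          _ = wt m ^ k * ‖a m‖ * (wt (n - m) ^ k * ‖b (n - m)‖) := by rw [mul_pow]; ring
          _ ≤ wt m ^ k * ‖a m‖ * C := by gcongr; exact hC _
    _ = (∑' m, wt m ^ k * ‖a m‖) * C := tsum_mul_right

theorem summable_conv_mul (θ : ℝ) {a b : ℤ × ℤ → ℂ} (ha : a ∈ rapid) (hb : b ∈ rapid)
    {F : ℤ × ℤ → ℂ} {C : ℝ} (hF : ∀ n, ‖F n‖ ≤ C) :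
    Summable fun p : (ℤ × ℤ) × (ℤ × ℤ) => a p.1 * b p.2 * cocycle θ p.1 p.2 * F (p.1 + p.2) := by
  have h := (rapid_summable_norm ha).mul_of_nonneg (rapid_summable_norm hb)
    (fun _ => norm_nonneg _) (fun _ => norm_nonneg _)
  refine Summable.of_norm_bounded (h.mul_right C) fun p => ?_
  rw [norm_mul, norm_mul, norm_mul, norm_cocycle, mul_one]
  exact mul_le_mul_of_nonneg_left (hF _) (by positivity)

theorem tsum_conv_mul (θ : ℝ) {a b : ℤ × ℤ → ℂ} (ha : a ∈ rapid) (hb : b ∈ rapid)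
    {F : ℤ × ℤ → ℂ} {C : ℝ} (hF : ∀ n, ‖F n‖ ≤ C) :
    ∑' n, twistedConv θ a b n * F n =
      ∑' p : (ℤ × ℤ) × (ℤ × ℤ), a p.1 * b p.2 * cocycle θ p.1 p.2 * F (p.1 + p.2) := by
  let e : (ℤ × ℤ) × (ℤ × ℤ) ≃ (ℤ × ℤ) × (ℤ × ℤ) :=
    { toFun := fun p => (p.2, p.1 - p.2)
      invFun := fun p => (p.1 + p.2, p.1)
      left_inv := fun p => by simp
      right_inv := fun p => by simp }
  have hs := summable_conv_mul θ ha hb hF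
  have hs' := (e.summable_iff).2 hs
  refine Eq.trans ?_ (hs'.tsum_prod.symm.trans (e.tsum_eq fun p =>
    a p.1 * b p.2 * cocycle θ p.1 p.2 * F (p.1 + p.2)))
  refine tsum_congr fun n => ?_
  rw [twistedConv, ← tsum_mul_right]
  refine tsum_congr fun m => ?_
  simp [e]

/-- The algebra `A_θ` of smooth functions on the noncommutative torus `T_θ`: the series
`∑ a_{n₁,n₂} U₁^{n₁} U₂^{n₂}` with rapidly decreasing coefficients, where
`U₁ U₂ = exp (2 π i θ) U₂ U₁`. -/
def NCTorus (_θ : ℝ) : Type := rapid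

namespace NCTorus

variable {θ : ℝ}

noncomputable instance : AddCommGroup (NCTorus θ) := inferInstanceAs (AddCommGroup rapid)

noncomputable instance : Module ℂ (NCTorus θ) := inferInstanceAs (Module ℂ rapid)

/-- The coefficient function `a_{n₁,n₂}`. -/
def coeff (a : NCTorus θ) : ℤ × ℤ → ℂ := a.1

theorem coeff_mem (a : NCTorus θ) : a.coeff ∈ rapid := a.2

/-- The series with given coefficients. -/
def ofCoeff (a : ℤ × ℤ → ℂ) (ha : a ∈ rapid) : NCTorus θ := ⟨a, ha⟩

@[simp] theorem coeff_ofCoeff (a : ℤ × ℤ → ℂ) (ha : a ∈ rapid) :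
    (ofCoeff a ha : NCTorus θ).coeff = a := rfl

theorem ext {a b : NCTorus θ} (h : ∀ n, a.coeff n = b.coeff n) : a = b := Subtype.ext (funext h)

@[simp] theorem coeff_add (a b : NCTorus θ) (n : ℤ × ℤ) :
    (a + b).coeff n = a.coeff n + b.coeff n := rfl

@[simp] theorem coeff_zero (n : ℤ × ℤ) : (0 : NCTorus θ).coeff n = 0 := rfl

@[simp] theorem coeff_smul (z : ℂ) (a : NCTorus θ) (n : ℤ × ℤ) :
    (z • a).coeff n = z * a.coeff n := rfl

theorem single_mem : (Pi.single 0 1 : ℤ × ℤ → ℂ) ∈ rapid := by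
  intro k
  refine ⟨wt 0 ^ k, fun n => ?_⟩
  have h := pow_pos (wt_pos 0) k
  by_cases hn : n = 0
  · subst hn; simp
  · rw [Pi.single_eq_of_ne hn]; simpa using h.le

noncomputable instance : Mul (NCTorus θ) :=
  ⟨fun a b => ofCoeff (twistedConv θ a.coeff b.coeff) (conv_mem θ a.2 b.2)⟩

noncomputable instance : One (NCTorus θ) := ⟨ofCoeff (Pi.single 0 1) single_mem⟩

theorem coeff_mul (a b : NCTorus θ) (n : ℤ × ℤ) :
    (a * b).coeff n = ∑' m, a.coeff m * b.coeff (n - m) * cocycle θ m (n - m) := rfl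

theorem coeff_one (n : ℤ × ℤ) : (1 : NCTorus θ).coeff n = if n = 0 then 1 else 0 := by
  change (Pi.single 0 1 : ℤ × ℤ → ℂ) n = _
  rw [Pi.single_apply]

protected theorem mul_assoc' (a b c : NCTorus θ) : a * b * c = a * (b * c) := by
  refine ext fun n => ?_
  obtain ⟨C, hC⟩ := rapid_bdd c.coeff_mem
  have h1 : (a * b * c).coeff n = ∑' p : (ℤ × ℤ) × (ℤ × ℤ),
      a.coeff p.1 * b.coeff p.2 * cocycle θ p.1 p.2 *
        (c.coeff (n - (p.1 + p.2)) * cocycle θ (p.1 + p.2) (n - (p.1 + p.2))) := by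
    rw [coeff_mul, ← tsum_conv_mul θ a.coeff_mem b.coeff_mem
      (F := fun j => c.coeff (n - j) * cocycle θ j (n - j)) (C := C)
      (fun j => by rw [norm_mul, norm_cocycle, mul_one]; exact hC _)]
    exact tsum_congr fun m => by rw [mul_assoc]; rfl
  have hs := summable_conv_mul θ a.coeff_mem b.coeff_mem
      (F := fun j => c.coeff (n - j) * cocycle θ j (n - j)) (C := C)
      (fun j => by rw [norm_mul, norm_cocycle, mul_one]; exact hC _)
  rw [h1, hs.tsum_prod, coeff_mul]
  refine tsum_congr fun m => ?_
  rw [coeff_mul, ← tsum_mul_left, ← tsum_mul_right]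
  refine tsum_congr fun k => ?_
  have hc : cocycle θ m k * cocycle θ (m + k) (n - (m + k)) =
      cocycle θ k (n - m - k) * cocycle θ m (n - m) := by
    simp only [cocycle, ← ex_add]
    congr 1
    simp only [Prod.fst_sub, Prod.fst_add, Prod.snd_add]
    push_cast; ring
  rw [sub_sub]
  rw [sub_sub] at hc
  linear_combination a.coeff m * b.coeff k * c.coeff (n - (m + k)) * hc

noncomputable instance : Ring (NCTorus θ) :=
  { (inferInstance : AddCommGroup (NCTorus θ)), (inferInstance : Mul (NCTorus θ)),
    (inferInstance : One (NCTorus θ)) with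
    mul_assoc := NCTorus.mul_assoc'
    one_mul := fun a => by
      refine ext fun n => ?_
      rw [coeff_mul, tsum_eq_single 0 (fun m hm => by rw [coeff_one, if_neg hm]; ring)]
      simp [coeff_one, cocycle, ex_zero]
    mul_one := fun a => by
      refine ext fun n => ?_
      rw [coeff_mul, tsum_eq_single n (fun m hm => by
        rw [coeff_one, if_neg (sub_ne_zero.2 hm.symm)]; ring)]
      simp [coeff_one, cocycle, ex_zero]
    left_distrib := fun a b c => by
      refine ext fun n => ?_
      rw [coeff_add, coeff_mul, coeff_mul, coeff_mul,
        ← (summable_conv θ a.coeff_mem b.coeff_mem n).tsum_add (summable_conv θ a.coeff_mem c.coeff_mem n)]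
      exact tsum_congr fun m => by rw [coeff_add]; ring
    right_distrib := fun a b c => by
      refine ext fun n => ?_
      rw [coeff_add, coeff_mul, coeff_mul, coeff_mul,
        ← (summable_conv θ a.coeff_mem c.coeff_mem n).tsum_add (summable_conv θ b.coeff_mem c.coeff_mem n)]
      exact tsum_congr fun m => by rw [coeff_add]; ring
    zero_mul := fun a => by refine ext fun n => ?_; simp [coeff_mul]
    mul_zero := fun a => by refine ext fun n => ?_; simp [coeff_mul] }

noncomputable instance : Algebra ℂ (NCTorus θ) :=
  Algebra.ofModule
    (fun z a b => by
      refine ext fun n => ?_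
      rw [coeff_smul, coeff_mul, coeff_mul, ← tsum_mul_left]
      exact tsum_congr fun m => by rw [coeff_smul]; ring)
    (fun z a b => by
      refine ext fun n => ?_
      rw [coeff_smul, coeff_mul, coeff_mul, ← tsum_mul_left]
      exact tsum_congr fun m => by rw [coeff_smul]; ring)

/-- The symbol `2 π i (n₁ τ + n₂)` of the derivation `δ_τ`. -/
noncomputable def deltaSymbol (τ : ℂ) (n : ℤ × ℤ) : ℂ := 2 * Real.pi * I * (n.1 * τ + n.2)

theorem norm_deltaSymbol_le (τ : ℂ) (n : ℤ × ℤ) :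
    ‖deltaSymbol τ n‖ ≤ 2 * Real.pi * (1 + ‖τ‖) * wt n ^ 1 := by
  have h0 : ‖(n.1 * τ + n.2 : ℂ)‖ ≤ (1 + ‖τ‖) * wt n := by
    have h := norm_add_le (n.1 * τ : ℂ) n.2
    rw [norm_mul, Complex.norm_intCast, Complex.norm_intCast] at h
    refine h.trans ?_
    rw [wt]
    nlinarith [norm_nonneg τ, abs_nonneg (n.1 : ℝ), abs_nonneg (n.2 : ℝ),
      mul_nonneg (norm_nonneg τ) (abs_nonneg (n.2 : ℝ))]
  have hp := Real.pi_pos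
  rw [deltaSymbol, norm_mul, norm_mul, norm_mul, Complex.norm_I, Complex.norm_ofNat,
    Complex.norm_real, Real.norm_of_nonneg hp.le, mul_one, pow_one, mul_assoc]
  rw [mul_assoc (2 * Real.pi), ← mul_assoc 2]
  exact mul_le_mul_of_nonneg_left h0 (by positivity)

/-- The derivation `δ_τ` of `A_θ` with `δ_τ(U₁) = 2 π i τ U₁` and `δ_τ(U₂) = 2 π i U₂`, that is
`δ_τ (∑ a_{n₁,n₂} U₁^{n₁} U₂^{n₂}) = 2 π i ∑ (n₁ τ + n₂) a_{n₁,n₂} U₁^{n₁} U₂^{n₂}`. -/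
noncomputable def delta (θ : ℝ) (τ : ℂ) : NCTorus θ →ₗ[ℂ] NCTorus θ where
  toFun a := ofCoeff (fun n => deltaSymbol τ n * a.coeff n)
    (rapid_mul a.2 _ 1 (norm_deltaSymbol_le τ))
  map_add' a b := ext fun n => by simp [mul_add]
  map_smul' z a := ext fun n => by simp; ring

theorem coeff_delta (τ : ℂ) (a : NCTorus θ) (n : ℤ × ℤ) :
    (delta θ τ a).coeff n = deltaSymbol τ n * a.coeff n := rfl

theorem delta_isDeriv (θ : ℝ) (τ : ℂ) : IsDeriv (delta θ τ) := by
  intro a b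
  refine ext fun n => ?_
  rw [coeff_add, coeff_delta, coeff_mul, coeff_mul, coeff_mul,
    ← (summable_conv θ (delta θ τ a).coeff_mem b.coeff_mem n).tsum_add (summable_conv θ a.coeff_mem (delta θ τ b).coeff_mem n),
    ← tsum_mul_left]
  refine tsum_congr fun m => ?_
  change _ = deltaSymbol τ m * a.coeff m * b.coeff (n - m) * _ +
    a.coeff m * (deltaSymbol τ (n - m) * b.coeff (n - m)) * _
  simp only [deltaSymbol, Prod.fst_sub, Prod.snd_sub]
  push_cast; ring

/-- The coefficients `a_{n₁,n₂}` of `a = ∑ a_{n₁,n₂} U₁^{n₁} U₂^{n₂}`. -/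
def toRapid (a : NCTorus θ) : rapid := a

theorem coeff_toRapid (a : NCTorus θ) (n : ℤ × ℤ) : a.toRapid.1 n = a.coeff n := rfl

/-- The coefficients of `a` with respect to the opposite order of the generators: since
`U₁^{n₁} U₂^{n₂} = exp (2 π i θ n₁ n₂) U₂^{n₂} U₁^{n₁}`, the series `∑ a_{n₁,n₂} U₁^{n₁} U₂^{n₂}` is
`∑ exp (2 π i θ n₁ n₂) a_{n₁,n₂} U₂^{n₂} U₁^{n₁}`. -/
noncomputable def reorder (a : NCTorus θ) : rapid :=
  ⟨fun n => ex (θ * n.1 * n.2) * a.coeff n,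
    rapid_mul a.2 1 0 (fun n => by rw [norm_ex, pow_zero, one_mul])⟩

theorem coeff_reorder (a : NCTorus θ) (n : ℤ × ℤ) :
    a.reorder.1 n = ex (θ * n.1 * n.2) * a.coeff n := rfl

end NCTorus

end NCTorusAlgebra
/-! ### Operators on Schwartz functions on `ℝ × ℤ/N` -/

section Schwartz

open Complex
open scoped SchwartzMap

theorem iteratedDeriv_cexp_ofReal (c : ℂ) (l : ℕ) :
    iteratedDeriv l (fun x : ℝ => Complex.exp (c * x)) = fun x : ℝ => c ^ l * Complex.exp (c * x) := by
  induction l with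
  | zero => simp
  | succ l ih =>
    rw [iteratedDeriv_succ, ih]
    funext x
    have h : HasDerivAt (fun y : ℝ => Complex.exp (c * y)) (Complex.exp (c * x) * (c * 1)) x :=
      ((Complex.ofRealCLM.hasDerivAt (x := x)).const_mul c).cexp
    rw [(h.const_mul (c ^ l)).deriv]
    ring

theorem ex_mul_eq (t : ℝ) : (fun x : ℝ => ex (t * x)) = fun x : ℝ =>
    Complex.exp (2 * Real.pi * I * t * x) := by
  funext x; rw [ex]; congr 1; push_cast; ring

theorem contDiff_ex_mul (t : ℝ) {N : WithTop ℕ∞} : ContDiff ℝ N fun x : ℝ => ex (t * x) := by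
  rw [ex_mul_eq]
  exact (contDiff_const.mul Complex.ofRealCLM.contDiff).cexp

theorem norm_iteratedFDeriv_ex_mul (t : ℝ) (l : ℕ) (x : ℝ) :
    ‖iteratedFDeriv ℝ l (fun x : ℝ => ex (t * x)) x‖ = (2 * Real.pi * |t|) ^ l := by
  rw [norm_iteratedFDeriv_eq_norm_iteratedDeriv, ex_mul_eq, iteratedDeriv_cexp_ofReal, norm_mul,
    norm_pow]
  have h1 : ‖Complex.exp (2 * Real.pi * I * t * x)‖ = 1 := by
    rw [Complex.norm_exp]; simp
  have h2 : ‖(2 * Real.pi * I * t : ℂ)‖ = 2 * Real.pi * |t| := by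
    simp [abs_of_pos Real.pi_pos]
  rw [h1, h2, mul_one]

theorem schwartz_term_contDiff (z : ℂ) (s t : ℝ) (g : 𝓢(ℝ, ℂ)) {N : ℕ∞} :
    ContDiff ℝ N fun x : ℝ => z * (ex (t * x) * g (x - s)) :=
  contDiff_const.mul ((contDiff_ex_mul t).mul ((g.smooth N).comp (contDiff_id.sub contDiff_const)))

theorem schwartz_term_bound (s w : ℝ) (g : 𝓢(ℝ, ℂ)) (k l : ℕ) :
    ∃ C : ℝ, 0 ≤ C ∧ ∀ (n : ℤ × ℤ) (z : ℂ) (x : ℝ),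
      ‖x‖ ^ k * ‖iteratedFDeriv ℝ l (fun y : ℝ => z * (ex (n.2 * w * y) * g (y - n.1 * s))) x‖ ≤
        C * (wt n ^ (k + l) * ‖z‖) := by
  let S : ℝ := 2 ^ k * (Finset.Iic (k, l)).sup (fun m => SchwartzMap.seminorm ℂ m.1 m.2) g
  have hS : ∀ j ≤ l, ∀ y : ℝ, (1 + ‖y‖) ^ k * ‖iteratedFDeriv ℝ j g y‖ ≤ S := fun j hj y =>
    SchwartzMap.one_add_le_sup_seminorm_apply (𝕜 := ℂ) (m := (k, l)) le_rfl hj g y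
  have hS0 : 0 ≤ S := le_trans (by positivity) (hS 0 (Nat.zero_le _) 0)
  let B : ℝ := 1 + 2 * Real.pi * |w|
  have hB : 1 ≤ B := by
    have : 0 ≤ 2 * Real.pi * |w| := by have := Real.pi_pos; positivity
    simp only [B]; linarith
  refine ⟨2 ^ l * B ^ l * (1 + |s|) ^ k * S, by positivity, fun n z x => ?_⟩
  have hw := one_le_wt n
  have hw0 := wt_pos n
  have hz : ‖iteratedFDeriv ℝ l (fun y : ℝ => z * (ex (n.2 * w * y) * g (y - n.1 * s))) x‖ =
      ‖z‖ * ‖iteratedFDeriv ℝ l (fun y : ℝ => ex (n.2 * w * y) * g (y - n.1 * s)) x‖ := by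
    rw [norm_iteratedFDeriv_eq_norm_iteratedDeriv, norm_iteratedFDeriv_eq_norm_iteratedDeriv,
      iteratedDeriv_const_mul_field, norm_mul]
  have hx : ‖x‖ ≤ (1 + |s|) * wt n * (1 + ‖x - n.1 * s‖) := by
    have h1 : ‖x‖ ≤ ‖x - n.1 * s‖ + |(n.1 : ℝ)| * |s| := by
      have := norm_add_le (x - n.1 * s) (n.1 * s)
      rwa [sub_add_cancel, Real.norm_eq_abs (_ * _), abs_mul] at this
    have h2 : |(n.1 : ℝ)| ≤ wt n := by
      rw [wt]; have := abs_nonneg (n.2 : ℝ); linarith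
    have h3 := norm_nonneg (x - n.1 * s)
    have h4 := abs_nonneg s
    have h5 : |(n.1 : ℝ)| * |s| ≤ wt n * |s| := mul_le_mul_of_nonneg_right h2 h4
    have h6 : ‖x - n.1 * s‖ ≤ wt n * ‖x - n.1 * s‖ := le_mul_of_one_le_left h3 hw
    have h7 : 0 ≤ |s| * wt n * ‖x - n.1 * s‖ := by positivity
    nlinarith
  have hmul := norm_iteratedFDeriv_mul_le (𝕜 := ℝ) (N := ((⊤ : ℕ∞) : WithTop ℕ∞))
    (contDiff_ex_mul (n.2 * w))
    ((g.smooth ⊤).comp (contDiff_id.sub (contDiff_const (c := (n.1 * s : ℝ))))) x (n := l)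
    (by exact_mod_cast le_top)
  have hterm : ∀ i ∈ Finset.range (l + 1),
      ‖x‖ ^ k * ((l.choose i : ℝ) * ‖iteratedFDeriv ℝ i (fun y : ℝ => ex (n.2 * w * y)) x‖ *
        ‖iteratedFDeriv ℝ (l - i) (⇑g ∘ fun y : ℝ => id y - n.1 * s) x‖) ≤
      (l.choose i : ℝ) * (B ^ l * (1 + |s|) ^ k * S * wt n ^ (k + l)) := by
    intro i hi
    have hi' : i ≤ l := Nat.lt_succ_iff.1 (Finset.mem_range.1 hi)
    have e1 : iteratedFDeriv ℝ (l - i) (⇑g ∘ fun y : ℝ => id y - n.1 * s) x =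
        iteratedFDeriv ℝ (l - i) g (x - n.1 * s) :=
      iteratedFDeriv_comp_sub (l - i) (n.1 * s : ℝ) x
    have e2 : (2 * Real.pi * |(n.2 : ℝ) * w|) ^ i ≤ B ^ l * wt n ^ l := by
      have h2 : |(n.2 : ℝ)| ≤ wt n := by
        rw [wt]; have := abs_nonneg (n.1 : ℝ); linarith
      have h3 : 2 * Real.pi * |(n.2 : ℝ) * w| ≤ B * wt n := by
        rw [abs_mul]
        have hp := Real.pi_pos
        have h4 : |(n.2 : ℝ)| * (2 * Real.pi * |w|) ≤ wt n * (2 * Real.pi * |w|) :=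
          mul_le_mul_of_nonneg_right h2 (by positivity)
        simp only [B]; nlinarith
      have h5 : 0 ≤ 2 * Real.pi * |(n.2 : ℝ) * w| := by have := Real.pi_pos; positivity
      have h6 : 1 ≤ B * wt n := one_le_mul_of_one_le_of_one_le hB hw
      calc (2 * Real.pi * |(n.2 : ℝ) * w|) ^ i ≤ (B * wt n) ^ i := by gcongr
        _ ≤ (B * wt n) ^ l := pow_le_pow_right₀ h6 hi'
        _ = B ^ l * wt n ^ l := mul_pow _ _ _
    have e3 : ‖x‖ ^ k * ‖iteratedFDeriv ℝ (l - i) g (x - n.1 * s)‖ ≤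
        (1 + |s|) ^ k * wt n ^ k * S := by
      calc ‖x‖ ^ k * ‖iteratedFDeriv ℝ (l - i) g (x - n.1 * s)‖
          ≤ ((1 + |s|) * wt n * (1 + ‖x - n.1 * s‖)) ^ k *
              ‖iteratedFDeriv ℝ (l - i) g (x - n.1 * s)‖ := by gcongr
        _ = (1 + |s|) ^ k * wt n ^ k * ((1 + ‖x - n.1 * s‖) ^ k *
              ‖iteratedFDeriv ℝ (l - i) g (x - n.1 * s)‖) := by rw [mul_pow, mul_pow]; ring
        _ ≤ (1 + |s|) ^ k * wt n ^ k * S := by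
            gcongr
            exact hS _ (Nat.sub_le _ _) _
    rw [norm_iteratedFDeriv_ex_mul, e1]
    calc ‖x‖ ^ k * ((l.choose i : ℝ) * (2 * Real.pi * |(n.2 : ℝ) * w|) ^ i *
          ‖iteratedFDeriv ℝ (l - i) g (x - n.1 * s)‖)
        = (l.choose i : ℝ) * ((2 * Real.pi * |(n.2 : ℝ) * w|) ^ i *
          (‖x‖ ^ k * ‖iteratedFDeriv ℝ (l - i) g (x - n.1 * s)‖)) := by ring
      _ ≤ (l.choose i : ℝ) * (B ^ l * wt n ^ l * ((1 + |s|) ^ k * wt n ^ k * S)) := by gcongr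
      _ = (l.choose i : ℝ) * (B ^ l * (1 + |s|) ^ k * S * wt n ^ (k + l)) := by
          rw [pow_add]; ring
  rw [hz]
  calc ‖x‖ ^ k * (‖z‖ * ‖iteratedFDeriv ℝ l (fun y : ℝ => ex (n.2 * w * y) * g (y - n.1 * s)) x‖)
      ≤ ‖x‖ ^ k * (‖z‖ * ∑ i ∈ Finset.range (l + 1), (l.choose i : ℝ) *
          ‖iteratedFDeriv ℝ i (fun y : ℝ => ex (n.2 * w * y)) x‖ *
          ‖iteratedFDeriv ℝ (l - i) (⇑g ∘ fun y : ℝ => id y - n.1 * s) x‖) := by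
        gcongr
        exact hmul
    _ = ‖z‖ * ∑ i ∈ Finset.range (l + 1), ‖x‖ ^ k * ((l.choose i : ℝ) *
          ‖iteratedFDeriv ℝ i (fun y : ℝ => ex (n.2 * w * y)) x‖ *
          ‖iteratedFDeriv ℝ (l - i) (⇑g ∘ fun y : ℝ => id y - n.1 * s) x‖) := by
        rw [Finset.mul_sum, Finset.mul_sum, Finset.mul_sum]
        refine Finset.sum_congr rfl fun i _ => ?_
        ring
    _ ≤ ‖z‖ * ∑ i ∈ Finset.range (l + 1),
          (l.choose i : ℝ) * (B ^ l * (1 + |s|) ^ k * S * wt n ^ (k + l)) :=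
        mul_le_mul_of_nonneg_left (Finset.sum_le_sum hterm) (norm_nonneg z)
    _ = 2 ^ l * B ^ l * (1 + |s|) ^ k * S * (wt n ^ (k + l) * ‖z‖) := by
        rw [← Finset.sum_mul]
        have : (∑ i ∈ Finset.range (l + 1), (l.choose i : ℝ)) = 2 ^ l := by
          exact_mod_cast Nat.sum_range_choose l
        rw [this]; ring

/-- The space `S(ℝ × ℤ/N)` of Schwartz functions `f(x, α)`, `x ∈ ℝ`, `α ∈ ℤ/N`; the value `f(x, α)`
is `f α x`. -/
def SchwartzMod (N : ℕ) : Type := ZMod N → 𝓢(ℝ, ℂ)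

namespace SchwartzMod

variable {N : ℕ}

noncomputable instance : AddCommGroup (SchwartzMod N) :=
  inferInstanceAs (AddCommGroup (ZMod N → 𝓢(ℝ, ℂ)))

noncomputable instance : Module ℂ (SchwartzMod N) :=
  inferInstanceAs (Module ℂ (ZMod N → 𝓢(ℝ, ℂ)))

/-- The value `f(x, α)`. -/
noncomputable def val (f : SchwartzMod N) (α : ZMod N) (x : ℝ) : ℂ := (f α : 𝓢(ℝ, ℂ)) x

theorem ext {f g : SchwartzMod N} (h : ∀ α x, f.val α x = g.val α x) : f = g :=
  funext fun α => SchwartzMap.ext fun x => h α x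

@[simp] theorem val_add (f g : SchwartzMod N) (α : ZMod N) (x : ℝ) :
    (f + g).val α x = f.val α x + g.val α x := rfl

@[simp] theorem val_smul (z : ℂ) (f : SchwartzMod N) (α : ZMod N) (x : ℝ) :
    (z • f).val α x = z * f.val α x := rfl

@[simp] theorem val_zero (α : ZMod N) (x : ℝ) : (0 : SchwartzMod N).val α x = 0 := rfl

theorem hasDerivAt_val (f : SchwartzMod N) (α : ZMod N) (x : ℝ) :
    HasDerivAt (f.val α) (deriv (f.val α) x) x :=
  ((f α : 𝓢(ℝ, ℂ)).differentiable.differentiableAt).hasDerivAt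

/-- The operator `f ↦ ∂f/∂x + 2 π i ν x f`. -/
noncomputable def conn (ν : ℂ) : SchwartzMod N →ₗ[ℂ] SchwartzMod N where
  toFun f := fun α => SchwartzMap.derivCLM ℂ ℂ (f α) +
    (2 * Real.pi * I * ν) • SchwartzMap.smulLeftCLM ℂ (fun x : ℝ => (x : ℂ)) (f α)
  map_add' f g := funext fun α => by
    change SchwartzMap.derivCLM ℂ ℂ (f α + g α) + (2 * Real.pi * I * ν) •
      SchwartzMap.smulLeftCLM ℂ (fun x : ℝ => (x : ℂ)) (f α + g α) = (_ + _) + (_ + _)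
    rw [map_add, map_add, smul_add]
    abel
  map_smul' z f := funext fun α => by
    change SchwartzMap.derivCLM ℂ ℂ (z • f α) + (2 * Real.pi * I * ν) •
      SchwartzMap.smulLeftCLM ℂ (fun x : ℝ => (x : ℂ)) (z • f α) = z • (_ + _)
    rw [map_smul, map_smul, smul_add, smul_comm z]

theorem val_conn (ν : ℂ) (f : SchwartzMod N) (α : ZMod N) (x : ℝ) :
    (conn ν f).val α x = deriv (f.val α) x + 2 * Real.pi * I * ν * x * f.val α x := by
  have h : (SchwartzMap.smulLeftCLM ℂ (fun x : ℝ => (x : ℂ)) (f α)) x = (x : ℂ) * f.val α x :=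
    SchwartzMap.smulLeftCLM_apply_apply Function.Complex.hasTemperateGrowth_ofReal _ _
  change SchwartzMap.derivCLM ℂ ℂ (f α) x + (2 * Real.pi * I * ν) *
    (SchwartzMap.smulLeftCLM ℂ (fun x : ℝ => (x : ℂ)) (f α)) x = _
  rw [h, SchwartzMap.derivCLM_apply, mul_assoc (2 * Real.pi * I * ν)]
  rfl

/-- Parameters `s, w ∈ ℝ` and `β, γ ∈ ℤ/N` of a pair of operators on functions of
`(x, α) ∈ ℝ × ℤ/N`: the translation `(V₁ f)(x, α) = f(x - s, α - β)` and the modulation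
`(V₂ f)(x, α) = exp (2 π i (w x + γ α / N)) f(x, α)`. -/
structure WeylPair (N : ℕ) where
  s : ℝ
  w : ℝ
  β : ZMod N
  γ : ZMod N

variable [NeZero N]

/-- The factor `exp (2 π i n₂ (w x + γ α / N))`. -/
noncomputable def WeylPair.phase (P : WeylPair N) (n : ℤ × ℤ) (α : ZMod N) (x : ℝ) : ℂ :=
  ex (n.2 * P.w * x) * ZMod.stdAddChar ((n.2 : ZMod N) * P.γ * α)

/-- The values of `V₂^{n₂} V₁^{n₁} f`. -/
noncomputable def WeylPair.term (P : WeylPair N) (n : ℤ × ℤ) (f : SchwartzMod N) (α : ZMod N)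
    (x : ℝ) : ℂ :=
  P.phase n α x * f.val (α - (n.1 : ZMod N) * P.β) (x - n.1 * P.s)

theorem norm_stdAddChar (j : ZMod N) : ‖(ZMod.stdAddChar j : ℂ)‖ = 1 := by
  rw [ZMod.stdAddChar_apply]; exact Circle.norm_coe _

namespace WeylPair

theorem norm_phase (P : WeylPair N) (n : ℤ × ℤ) (α : ZMod N) (x : ℝ) : ‖P.phase n α x‖ = 1 := by
  rw [phase, norm_mul, norm_ex, norm_stdAddChar, mul_one]

theorem exists_term_bound (P : WeylPair N) (f : SchwartzMod N) (k l : ℕ) :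
    ∃ C : ℝ, ∀ (n : ℤ × ℤ) (z : ℂ) (α : ZMod N) (x : ℝ),
      ‖x‖ ^ k * ‖iteratedFDeriv ℝ l (fun y => z * P.term n f α y) x‖ ≤
        C * (wt n ^ (k + l) * ‖z‖) := by
  choose C hC0 hC using fun j : ZMod N => schwartz_term_bound P.s P.w (f j) k l
  refine ⟨∑ j, C j, fun n z α x => ?_⟩
  have h := hC (α - (n.1 : ZMod N) * P.β) n
    (z * ZMod.stdAddChar ((n.2 : ZMod N) * P.γ * α)) x
  rw [norm_mul z, norm_stdAddChar, mul_one] at h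
  have e : (fun y : ℝ => z * P.term n f α y) = fun y : ℝ =>
      z * ZMod.stdAddChar ((n.2 : ZMod N) * P.γ * α) *
        (ex (n.2 * P.w * y) * f (α - (n.1 : ZMod N) * P.β) (y - n.1 * P.s)) := by
    funext y; rw [term, phase, val]; ring
  rw [e]
  refine h.trans (mul_le_mul_of_nonneg_right ?_ ?_)
  · exact Finset.single_le_sum (fun j _ => hC0 j) (Finset.mem_univ _)
  · have := wt_pos n; positivity

theorem term_contDiff (P : WeylPair N) (f : SchwartzMod N) (n : ℤ × ℤ) (z : ℂ) (α : ZMod N)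
    {M : ℕ∞} : ContDiff ℝ M fun y => z * P.term n f α y := by
  have e : (fun y : ℝ => z * P.term n f α y) = fun y : ℝ =>
      z * ZMod.stdAddChar ((n.2 : ZMod N) * P.γ * α) *
        (ex (n.2 * P.w * y) * f (α - (n.1 : ZMod N) * P.β) (y - n.1 * P.s)) := by
    funext y; rw [term, phase, val]; ring
  rw [e]
  exact schwartz_term_contDiff _ _ _ _

theorem exists_norm_term_le (P : WeylPair N) (f : SchwartzMod N) :
    ∃ C : ℝ, ∀ n α x, ‖P.term n f α x‖ ≤ C := by
  obtain ⟨C, hC⟩ := P.exists_term_bound f 0 0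
  refine ⟨C, fun n α x => ?_⟩
  simpa [norm_iteratedFDeriv_zero] using hC n 1 α x

theorem summable_term (P : WeylPair N) {u : ℤ × ℤ → ℂ} (hu : u ∈ rapid) (f : SchwartzMod N)
    (α : ZMod N) (x : ℝ) : Summable fun n => u n * P.term n f α x := by
  obtain ⟨C, hC⟩ := P.exists_norm_term_le f
  refine Summable.of_norm_bounded ((rapid_summable_norm hu).mul_right C) fun n => ?_
  rw [norm_mul]
  exact mul_le_mul_of_nonneg_left (hC _ _ _) (norm_nonneg _)

/-- The operator `∑ u_{n₁,n₂} V₂^{n₂} V₁^{n₁}`, for a rapidly decreasing `u`. -/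
noncomputable def opSum (P : WeylPair N) (u : rapid) (f : SchwartzMod N) : SchwartzMod N :=
  fun α =>
  { toFun := fun x => ∑' n, u.1 n * P.term n f α x
    smooth' := by
      choose C hC using fun l => P.exists_term_bound f 0 l
      refine contDiff_tsum (N := ⊤) (v := fun l n => C l * (wt n ^ (0 + l) * ‖u.1 n‖))
        (fun n => P.term_contDiff f n (u.1 n) α)
        (fun l _ => (rapid_summable u.2 _).mul_left _) (fun l n x _ => ?_)
      simpa using hC l n (u.1 n) α x
    decay' := by
      intro k l
      choose C hC using fun l => P.exists_term_bound f 0 l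
      obtain ⟨D, hD⟩ := P.exists_term_bound f k l
      refine ⟨∑' n, D * (wt n ^ (k + l) * ‖u.1 n‖), fun x => ?_⟩
      have hs : Summable fun n => D * (wt n ^ (k + l) * ‖u.1 n‖) :=
        (rapid_summable u.2 _).mul_left _
      rw [iteratedFDeriv_tsum_apply (N := ⊤) (v := fun l n => C l * (wt n ^ (0 + l) * ‖u.1 n‖))
        (fun n => P.term_contDiff f n (u.1 n) α)
        (fun l _ => (rapid_summable u.2 _).mul_left _)
        (fun l n x _ => by simpa using hC l n (u.1 n) α x) (by exact_mod_cast le_top)]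
      have hs1 : Summable fun n => ‖iteratedFDeriv ℝ l (fun y => u.1 n * P.term n f α y) x‖ := by
        refine Summable.of_nonneg_of_le (fun n => norm_nonneg _) (fun n => ?_)
          ((rapid_summable u.2 (0 + l)).mul_left (C l))
        simpa using hC l n (u.1 n) α x
      calc ‖x‖ ^ k * ‖∑' n, iteratedFDeriv ℝ l (fun y => u.1 n * P.term n f α y) x‖
          ≤ ‖x‖ ^ k * ∑' n, ‖iteratedFDeriv ℝ l (fun y => u.1 n * P.term n f α y) x‖ := by
            gcongr
            exact norm_tsum_le_tsum_norm hs1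
        _ = ∑' n, ‖x‖ ^ k * ‖iteratedFDeriv ℝ l (fun y => u.1 n * P.term n f α y) x‖ :=
            tsum_mul_left.symm
        _ ≤ ∑' n, D * (wt n ^ (k + l) * ‖u.1 n‖) :=
            (hs1.mul_left _).tsum_le_tsum (fun n => hD n (u.1 n) α x) hs }

theorem val_opSum (P : WeylPair N) (u : rapid) (f : SchwartzMod N) (α : ZMod N) (x : ℝ) :
    (P.opSum u f).val α x = ∑' n, u.1 n * P.term n f α x := rfl

theorem term_add (P : WeylPair N) (n : ℤ × ℤ) (f g : SchwartzMod N) (α : ZMod N) (x : ℝ) :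
    P.term n (f + g) α x = P.term n f α x + P.term n g α x := by
  rw [term, term, term, val_add, mul_add]

theorem term_smul (P : WeylPair N) (n : ℤ × ℤ) (z : ℂ) (f : SchwartzMod N) (α : ZMod N) (x : ℝ) :
    P.term n (z • f) α x = z * P.term n f α x := by
  rw [term, term, val_smul, mul_left_comm]

theorem opSum_add (P : WeylPair N) (u : rapid) (f g : SchwartzMod N) :
    P.opSum u (f + g) = P.opSum u f + P.opSum u g := by
  refine SchwartzMod.ext fun α x => ?_
  rw [val_add, val_opSum, val_opSum, val_opSum,
    ← (P.summable_term u.2 f α x).tsum_add (P.summable_term u.2 g α x)]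
  exact tsum_congr fun n => by rw [term_add, mul_add]

theorem opSum_smul (P : WeylPair N) (u : rapid) (z : ℂ) (f : SchwartzMod N) :
    P.opSum u (z • f) = z • P.opSum u f := by
  refine SchwartzMod.ext fun α x => ?_
  rw [val_smul, val_opSum, val_opSum, ← tsum_mul_left]
  exact tsum_congr fun n => by rw [term_smul, mul_left_comm]

theorem add_opSum (P : WeylPair N) (u v : rapid) (f : SchwartzMod N) :
    P.opSum (u + v) f = P.opSum u f + P.opSum v f := by
  refine SchwartzMod.ext fun α x => ?_
  rw [val_add, val_opSum, val_opSum, val_opSum,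
    ← (P.summable_term u.2 f α x).tsum_add (P.summable_term v.2 f α x)]
  exact tsum_congr fun n => add_mul _ _ _

theorem smul_opSum (P : WeylPair N) (z : ℂ) (u : rapid) (f : SchwartzMod N) :
    P.opSum (z • u) f = z • P.opSum u f := by
  refine SchwartzMod.ext fun α x => ?_
  rw [val_smul, val_opSum, val_opSum, ← tsum_mul_left]
  exact tsum_congr fun n => mul_assoc _ _ _

theorem phase_zero (P : WeylPair N) (α : ZMod N) (x : ℝ) : P.phase 0 α x = 1 := by
  simp [phase, ex_zero]

theorem phase_add (P : WeylPair N) (m n : ℤ × ℤ) (α : ZMod N) (x : ℝ) :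
    P.phase (m + n) α x = P.phase m α x * P.phase n α x := by
  have e1 : ((m + n).2 * P.w * x : ℝ) = m.2 * P.w * x + n.2 * P.w * x := by
    rw [Prod.snd_add]; push_cast; ring
  have e2 : (((m + n).2 : ℤ) : ZMod N) * P.γ * α =
      (m.2 : ZMod N) * P.γ * α + (n.2 : ZMod N) * P.γ * α := by
    rw [Prod.snd_add]; push_cast; ring
  rw [phase, phase, phase, e1, e2, ex_add, AddChar.map_add_eq_mul]
  ring

theorem term_zero (P : WeylPair N) (f : SchwartzMod N) (α : ZMod N) (x : ℝ) :
    P.term 0 f α x = f.val α x := by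
  simp [term, phase_zero]

/-- The scalar `κ` with `W₁ V₂ = κ V₂ W₁`, where `V₂` is the modulation of `Q` and `W₁` is the
translation of `P`. -/
noncomputable def kappa (Q P : WeylPair N) : ℂ :=
  ex (-(Q.w * P.s)) * ZMod.stdAddChar (-(Q.γ * P.β))

theorem phase_sub (Q P : WeylPair N) (m : ℤ × ℤ) (k : ℤ) (α : ZMod N) (x : ℝ) :
    Q.phase m (α - (k : ZMod N) * P.β) (x - k * P.s) =
      kappa Q P ^ (m.2 * k) * Q.phase m α x := by
  have e1 : (m.2 * Q.w * (x - k * P.s) : ℝ) =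
      ((m.2 * k : ℤ) : ℝ) * (-(Q.w * P.s)) + m.2 * Q.w * x := by push_cast; ring
  have e2 : (m.2 : ZMod N) * Q.γ * (α - (k : ZMod N) * P.β) =
      (m.2 * k) • (-(Q.γ * P.β)) + (m.2 : ZMod N) * Q.γ * α := by
    rw [zsmul_eq_mul]; push_cast; ring
  rw [phase, phase, kappa, e1, e2, ex_add, AddChar.map_add_eq_mul, mul_zpow, ex_zpow,
    AddChar.map_zsmul_eq_zpow]
  ring

theorem term_sub (Q P : WeylPair N) (m : ℤ × ℤ) (k : ℤ) (f : SchwartzMod N) (α : ZMod N) (x : ℝ) :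
    Q.term m f (α - (k : ZMod N) * P.β) (x - k * P.s) =
      kappa Q P ^ (m.2 * k) * (Q.phase m α x *
        f.val (α - ((k : ZMod N) * P.β + (m.1 : ZMod N) * Q.β)) (x - (k * P.s + m.1 * Q.s))) := by
  rw [term, phase_sub, sub_sub, sub_sub, mul_assoc]

theorem summable_opSum_opSum (P Q : WeylPair N) (v u : rapid) (f : SchwartzMod N) (α : ZMod N)
    (x : ℝ) : Summable fun p : (ℤ × ℤ) × (ℤ × ℤ) => v.1 p.1 * u.1 p.2 *
      (P.phase p.1 α x * Q.term p.2 f (α - (p.1.1 : ZMod N) * P.β) (x - p.1.1 * P.s)) := by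
  obtain ⟨C, hC⟩ := Q.exists_norm_term_le f
  have h := (rapid_summable_norm v.2).mul_of_nonneg (rapid_summable_norm u.2)
    (fun _ => norm_nonneg _) (fun _ => norm_nonneg _)
  refine Summable.of_norm_bounded (h.mul_right C) fun p => ?_
  rw [norm_mul, norm_mul, norm_mul, norm_phase, one_mul]
  exact mul_le_mul_of_nonneg_left (hC _ _ _) (by positivity)

theorem val_opSum_opSum (P Q : WeylPair N) (v u : rapid) (f : SchwartzMod N) (α : ZMod N)
    (x : ℝ) : (P.opSum v (Q.opSum u f)).val α x =
      ∑' p : (ℤ × ℤ) × (ℤ × ℤ), v.1 p.1 * u.1 p.2 *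
        (P.phase p.1 α x * Q.term p.2 f (α - (p.1.1 : ZMod N) * P.β) (x - p.1.1 * P.s)) := by
  rw [(summable_opSum_opSum P Q v u f α x).tsum_prod, val_opSum]
  refine tsum_congr fun k => ?_
  rw [term, val_opSum, ← tsum_mul_left, ← tsum_mul_left]
  exact tsum_congr fun m => by ring

theorem opSum_conv (P : WeylPair N) (θ : ℝ) (a b : NCTorus θ) (ω : ℤ × ℤ → ℂ)
    (hω : ∀ n, ‖ω n‖ = 1) (u : rapid) (hu : ∀ n, u.1 n = ω n * (a * b).coeff n)
    (f : SchwartzMod N) (α : ZMod N) (x : ℝ) :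
    (P.opSum u f).val α x = ∑' p : (ℤ × ℤ) × (ℤ × ℤ), a.coeff p.1 * b.coeff p.2 *
      cocycle θ p.1 p.2 * (ω (p.1 + p.2) * P.term (p.1 + p.2) f α x) := by
  obtain ⟨C, hC⟩ := P.exists_norm_term_le f
  rw [val_opSum, ← tsum_conv_mul θ a.coeff_mem b.coeff_mem
    (F := fun n => ω n * P.term n f α x) (C := C)
    (fun n => by rw [norm_mul, hω, one_mul]; exact hC _ _ _)]
  refine tsum_congr fun n => ?_
  rw [hu, mul_comm (ω n), mul_assoc]
  rfl

theorem shift_add (P : WeylPair N) (m n : ℤ × ℤ) (f : SchwartzMod N) (α : ZMod N) (x : ℝ) :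
    P.term (m + n) f α x = P.phase m α x * P.phase n α x *
      f.val (α - ((m.1 : ZMod N) * P.β + (n.1 : ZMod N) * P.β)) (x - (m.1 * P.s + n.1 * P.s)) := by
  rw [term, phase_add, Prod.fst_add]
  push_cast
  rw [add_mul, add_mul]

theorem opSum_mul_right (P : WeylPair N) {θ : ℝ} (h : kappa P P = ex (-θ)) (a b : NCTorus θ)
    (f : SchwartzMod N) : P.opSum (a * b).toRapid f = P.opSum b.toRapid (P.opSum a.toRapid f) := by
  refine SchwartzMod.ext fun α x => ?_
  rw [P.opSum_conv θ a b (fun _ => 1) (fun _ => norm_one) (a * b).toRapid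
      (fun n => (one_mul _).symm),
    val_opSum_opSum, ← (Equiv.prodComm (ℤ × ℤ) (ℤ × ℤ)).tsum_eq]
  refine tsum_congr fun p => ?_
  have hc : cocycle θ p.2 p.1 = ex (-θ) ^ (p.2.2 * p.1.1) := by
    rw [cocycle, ex_zpow]; congr 1; push_cast; ring
  simp only [Equiv.prodComm_apply, Prod.fst_swap, Prod.snd_swap, term_sub, h, hc, shift_add,
    NCTorus.coeff_toRapid]
  rw [add_comm ((p.1.1 : ZMod N) * P.β), add_comm (p.1.1 * P.s)]
  ring

theorem opSum_mul_left (P : WeylPair N) {θ : ℝ} (h : kappa P P = ex θ) (a b : NCTorus θ)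
    (f : SchwartzMod N) :
    P.opSum (a * b).reorder f = P.opSum a.reorder (P.opSum b.reorder f) := by
  refine SchwartzMod.ext fun α x => ?_
  rw [P.opSum_conv θ a b (fun n => ex (θ * n.1 * n.2)) (fun _ => norm_ex _) _ (fun n => rfl),
    val_opSum_opSum]
  refine tsum_congr fun p => ?_
  have hc : cocycle θ p.1 p.2 * ex (θ * (p.1 + p.2).1 * (p.1 + p.2).2) =
      ex (θ * p.1.1 * p.1.2) * ex (θ * p.2.1 * p.2.2) * ex θ ^ (p.2.2 * p.1.1) := by
    rw [cocycle, ex_zpow, ← ex_add, ← ex_add, ← ex_add, Prod.fst_add, Prod.snd_add]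
    congr 1; push_cast; ring
  simp only [term_sub, h, shift_add, NCTorus.coeff_reorder]
  linear_combination a.coeff p.1 * b.coeff p.2 * P.phase p.1 α x * P.phase p.2 α x *
    f.val (α - ((p.1.1 : ZMod N) * P.β + (p.2.1 : ZMod N) * P.β))
      (x - (p.1.1 * P.s + p.2.1 * P.s)) * hc

theorem opSum_one (P : WeylPair N) (u : rapid) (hu : ∀ n, u.1 n = if n = 0 then 1 else 0)
    (f : SchwartzMod N) : P.opSum u f = f := by
  refine SchwartzMod.ext fun α x => ?_
  rw [val_opSum, tsum_eq_single 0 (fun n hn => by rw [hu, if_neg hn, zero_mul]), hu, if_pos rfl,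
    term_zero, one_mul]

theorem opSum_zero (P : WeylPair N) (u : rapid) : P.opSum u 0 = 0 := by
  refine SchwartzMod.ext fun α x => ?_
  simp [val_opSum, term]

theorem zero_opSum (P : WeylPair N) (f : SchwartzMod N) : P.opSum 0 f = 0 := by
  refine SchwartzMod.ext fun α x => ?_
  simp [val_opSum]

theorem opSum_comm (P Q : WeylPair N) (h1 : kappa Q P = 1) (h2 : kappa P Q = 1) (v u : rapid)
    (f : SchwartzMod N) : P.opSum v (Q.opSum u f) = Q.opSum u (P.opSum v f) := by
  refine SchwartzMod.ext fun α x => ?_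
  rw [val_opSum_opSum, val_opSum_opSum, ← (Equiv.prodComm (ℤ × ℤ) (ℤ × ℤ)).tsum_eq]
  refine tsum_congr fun p => ?_
  simp only [Equiv.prodComm_apply, Prod.fst_swap, Prod.snd_swap, term_sub, h1, h2, one_zpow,
    one_mul]
  rw [add_comm ((p.2.1 : ZMod N) * P.β), add_comm (p.2.1 * P.s)]
  ring

end WeylPair

theorem WeylPair.hasDerivAt_term (P : WeylPair N) (n : ℤ × ℤ) (f : SchwartzMod N) (α : ZMod N)
    (x : ℝ) : HasDerivAt (P.term n f α) (2 * Real.pi * I * (n.2 * P.w) * P.term n f α x +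
      P.phase n α x * deriv (f.val (α - (n.1 : ZMod N) * P.β)) (x - n.1 * P.s)) x := by
  have h1 : HasDerivAt (fun y : ℝ => ex (n.2 * P.w * y))
      (2 * Real.pi * I * (n.2 * P.w) * ex (n.2 * P.w * x)) x := by
    have h : HasDerivAt (fun y : ℝ => Complex.exp (2 * Real.pi * I * ((n.2 * P.w : ℝ) : ℂ) * y))
        (Complex.exp (2 * Real.pi * I * ((n.2 * P.w : ℝ) : ℂ) * x) *
          (2 * Real.pi * I * ((n.2 * P.w : ℝ) : ℂ) * 1)) x :=
      ((Complex.ofRealCLM.hasDerivAt (x := x)).const_mul _).cexp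
    rw [← ex_mul_eq] at h
    convert h using 1
    rw [← congrFun (ex_mul_eq (n.2 * P.w)) x]
    push_cast; ring
  have h2 : HasDerivAt (fun y : ℝ => f.val (α - (n.1 : ZMod N) * P.β) (y - n.1 * P.s))
      (deriv (f.val (α - (n.1 : ZMod N) * P.β)) (x - n.1 * P.s)) x :=
    (hasDerivAt_val f _ _).comp_sub_const x _
  have h3 := (h1.mul_const (ZMod.stdAddChar ((n.2 : ZMod N) * P.γ * α) : ℂ)).mul h2
  refine HasDerivAt.congr_deriv (f := P.term n f α) h3 ?_
  simp only [WeylPair.term, WeylPair.phase]; ring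

theorem WeylPair.conn_opSum (P : WeylPair N) (ν : ℂ) (u v : rapid)
    (hv : ∀ n, v.1 n = 2 * Real.pi * I * (n.2 * P.w + ν * (n.1 * P.s)) * u.1 n)
    (f : SchwartzMod N) :
    conn ν (P.opSum u f) = P.opSum u (conn ν f) + P.opSum v f := by
  refine SchwartzMod.ext fun α x => ?_
  have hd : deriv ((P.opSum u f).val α) x = ∑' n, u.1 n * (2 * Real.pi * I * (n.2 * P.w) *
      P.term n f α x +
      P.phase n α x * deriv (f.val (α - (n.1 : ZMod N) * P.β)) (x - n.1 * P.s)) := by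
    obtain ⟨C, hC⟩ := P.exists_term_bound f 0 1
    have hdn : ∀ n y, HasDerivAt (fun y => u.1 n * P.term n f α y) (u.1 n *
        (2 * Real.pi * I * (n.2 * P.w) * P.term n f α y +
        P.phase n α y * deriv (f.val (α - (n.1 : ZMod N) * P.β)) (y - n.1 * P.s))) y :=
      fun n y => (P.hasDerivAt_term n f α y).const_mul (u.1 n)
    have h := hasDerivAt_tsum (u := fun n => C * (wt n ^ (0 + 1) * ‖u.1 n‖))
      ((rapid_summable u.2 _).mul_left C) hdn
      (fun n y => by
        have h := hC n (u.1 n) α y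
        rw [norm_iteratedFDeriv_eq_norm_iteratedDeriv, iteratedDeriv_one, (hdn n y).deriv] at h
        simpa using h)
      (P.summable_term u.2 f α x) x
    exact h.deriv
  rw [val_conn, val_add, hd, val_opSum, val_opSum, val_opSum, ← tsum_mul_left,
    ← (P.summable_term u.2 (conn ν f) α x).tsum_add (P.summable_term v.2 f α x)]
  have hs1 : Summable fun n => u.1 n * (2 * Real.pi * I * (n.2 * P.w) * P.term n f α x +
      P.phase n α x * deriv (f.val (α - (n.1 : ZMod N) * P.β)) (x - n.1 * P.s)) := by
    have h1 := (P.summable_term u.2 (conn ν f) α x).add (P.summable_term v.2 f α x)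
    have h2 := (P.summable_term u.2 f α x).mul_left (2 * Real.pi * I * ν * x)
    refine (h1.sub h2).congr fun n => ?_
    rw [hv, term, term, val_conn]
    push_cast; ring
  rw [← hs1.tsum_add ((P.summable_term u.2 f α x).mul_left _)]
  refine tsum_congr fun n => ?_
  rw [hv, term, term, val_conn]
  push_cast; ring

end SchwartzMod

end Schwartz
/-! ### Basic modules and homogeneous coordinate algebras -/

section RealMultiplication

open Complex MulOpposite Matrix

/-- `g ∈ SL₂(ℤ)` has lower left entry `c > 0`, and `r` is a real positive eigenvalue of `g` (the
other eigenvalue is then `r⁻¹`, so that all eigenvalues of `g` are real and positive). -/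
structure IsRM (g : SpecialLinearGroup (Fin 2) ℤ) (r : ℝ) : Prop where
  c_pos : 0 < g.1 1 0
  r_pos : 0 < r
  eigen : Module.End.HasEigenvalue (Matrix.toLin' (g.1.map (Int.cast : ℤ → ℝ))) r

variable {g : SpecialLinearGroup (Fin 2) ℤ} {r : ℝ}

theorem sl_det (g : SpecialLinearGroup (Fin 2) ℤ) :
    (g.1 0 0 : ℝ) * g.1 1 1 - g.1 0 1 * g.1 1 0 = 1 := by
  have h := g.2
  rw [Matrix.det_fin_two] at h
  exact_mod_cast h

theorem hasEigenvalue_iff_quadratic (g : SpecialLinearGroup (Fin 2) ℤ) (r : ℝ) :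
    Module.End.HasEigenvalue (Matrix.toLin' (g.1.map (Int.cast : ℤ → ℝ))) r ↔
      r ^ 2 - (g.1 0 0 + g.1 1 1) * r + 1 = 0 := by
  have h := sl_det g
  rw [Module.End.hasEigenvalue_iff_isRoot_charpoly, Matrix.charpoly_toLin', Polynomial.IsRoot.def,
    Matrix.charpoly_fin_two, Matrix.trace_fin_two, Matrix.det_fin_two]
  simp only [Matrix.map_apply, Polynomial.eval_add, Polynomial.eval_sub, Polynomial.eval_mul,
    Polynomial.eval_pow, Polynomial.eval_X, Polynomial.eval_C]
  rw [h]

theorem IsRM.quadratic (h : IsRM g r) : r ^ 2 - (g.1 0 0 + g.1 1 1) * r + 1 = 0 :=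
  (hasEigenvalue_iff_quadratic g r).1 h.eigen

/-- The matrix `g'` obtained from `g` by exchanging the diagonal entries. -/
def swapDiag (g : SpecialLinearGroup (Fin 2) ℤ) : SpecialLinearGroup (Fin 2) ℤ :=
  ⟨!![g.1 1 1, g.1 0 1; g.1 1 0, g.1 0 0], by
    have h := g.2
    rw [Matrix.det_fin_two] at h
    rw [Matrix.det_fin_two_of, mul_comm (g.1 1 1)]
    exact h⟩

theorem IsRM.swap (h : IsRM g r) : IsRM (swapDiag g) r⁻¹ where
  c_pos := h.c_pos
  r_pos := inv_pos.2 h.r_pos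
  eigen := by
    rw [hasEigenvalue_iff_quadratic]
    have hq := h.quadratic
    have hr := h.r_pos.ne'
    change r⁻¹ ^ 2 - ((g.1 1 1 : ℝ) + g.1 0 0) * r⁻¹ + 1 = 0
    field_simp
    linarith

/-- The real number `θ = (r - d) / c`, for which `r = c θ + d` and `g θ = θ`. -/
noncomputable def rmTheta (g : SpecialLinearGroup (Fin 2) ℤ) (r : ℝ) : ℝ :=
  (r - g.1 1 1) / g.1 1 0

/-- The order of the finite group `ℤ/cℤ`. -/
def rmOrder (g : SpecialLinearGroup (Fin 2) ℤ) : ℕ := (g.1 1 0).natAbs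

theorem IsRM.neZero (h : IsRM g r) : NeZero (rmOrder g) :=
  ⟨Int.natAbs_ne_zero.2 h.c_pos.ne'⟩

theorem IsRM.cast_order (h : IsRM g r) : (rmOrder g : ℤ) = g.1 1 0 :=
  Int.natAbs_of_nonneg h.c_pos.le

theorem IsRM.cast_order_real (h : IsRM g r) : ((rmOrder g : ℕ) : ℝ) = g.1 1 0 := by
  exact_mod_cast congrArg (Int.cast (R := ℝ)) h.cast_order

namespace SchwartzMod

/-- The operators of the right action on `E_g(θ)`, where `r = c θ + d`:
`(f U₁)(x, α) = f(x - r / c, α - 1)` and `(f U₂)(x, α) = exp (2 π i (x - α d / c)) f(x, α)`. -/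
noncomputable def rightPair (g : SpecialLinearGroup (Fin 2) ℤ) (r : ℝ) : WeylPair (rmOrder g) where
  s := r / g.1 1 0
  w := 1
  β := 1
  γ := -(g.1 1 1 : ZMod (rmOrder g))

/-- The operators of the left action on `E_g(θ)`, where `r = c θ + d`:
`(U₁ f)(x, α) = f(x - 1 / c, α - a)` and `(U₂ f)(x, α) = exp (2 π i (x / r - α / c)) f(x, α)`. -/
noncomputable def leftPair (g : SpecialLinearGroup (Fin 2) ℤ) (r : ℝ) : WeylPair (rmOrder g) where
  s := 1 / g.1 1 0
  w := 1 / r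
  β := (g.1 0 0 : ZMod (rmOrder g))
  γ := -1

theorem stdAddChar_eq_ex {N : ℕ} [NeZero N] (j : ℤ) :
    (ZMod.stdAddChar (j : ZMod N) : ℂ) = ex (j / N) := by
  rw [ZMod.stdAddChar_coe, ex]
  congr 1; push_cast; ring

theorem kappa_eq {N : ℕ} [NeZero N] (Q P : WeylPair N) (j : ℤ)
    (hj : -(Q.γ * P.β) = (j : ZMod N)) :
    WeylPair.kappa Q P = ex (-(Q.w * P.s) + j / N) := by
  rw [WeylPair.kappa, hj, stdAddChar_eq_ex, ex_add]

section

variable [NeZero (rmOrder g)]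

theorem kappa_right (h : IsRM g r) :
    WeylPair.kappa (rightPair g r) (rightPair g r) = ex (-rmTheta g r) := by
  rw [kappa_eq _ _ (g.1 1 1) (by simp [rightPair])]
  have hN : ((rmOrder g : ℕ) : ℝ) = g.1 1 0 := h.cast_order_real
  congr 1
  rw [hN, rmTheta]
  simp only [rightPair]
  ring

theorem kappa_left (h : IsRM g r) :
    WeylPair.kappa (leftPair g r) (leftPair g r) = ex (rmTheta g r) := by
  rw [kappa_eq _ _ (g.1 0 0) (by simp [leftPair])]
  have hN : ((rmOrder g : ℕ) : ℝ) = g.1 1 0 := h.cast_order_real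
  have hc : (g.1 1 0 : ℝ) ≠ 0 := by exact_mod_cast h.c_pos.ne'
  have hr := h.r_pos.ne'
  have hq := h.quadratic
  congr 1
  rw [hN, rmTheta]
  simp only [leftPair]
  field_simp
  linarith

theorem kappa_right_left (h : IsRM g r) :
    WeylPair.kappa (rightPair g r) (leftPair g r) = 1 := by
  rw [kappa_eq _ _ (g.1 1 1 * g.1 0 0) (by simp [leftPair, rightPair])]
  have hN : ((rmOrder g : ℕ) : ℝ) = g.1 1 0 := h.cast_order_real
  have hc : (g.1 1 0 : ℝ) ≠ 0 := by exact_mod_cast h.c_pos.ne'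
  have hd := sl_det g
  rw [← ex_intCast (g.1 0 1)]
  congr 1
  rw [hN]
  simp only [leftPair, rightPair]
  push_cast
  field_simp
  linarith

theorem kappa_left_right (h : IsRM g r) :
    WeylPair.kappa (leftPair g r) (rightPair g r) = 1 := by
  rw [kappa_eq _ _ 1 (by simp [leftPair, rightPair])]
  have hN : ((rmOrder g : ℕ) : ℝ) = g.1 1 0 := h.cast_order_real
  have hc : (g.1 1 0 : ℝ) ≠ 0 := by exact_mod_cast h.c_pos.ne'
  have hr := h.r_pos.ne'
  rw [← ex_zero]
  congr 1
  rw [hN]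
  simp only [leftPair, rightPair]
  push_cast
  field_simp
  ring

/-- The right `A_θ`-module structure of `E_g(θ)`:
`f a = ∑ a_{n₁,n₂} (f U₁^{n₁}) U₂^{n₂}`. -/
@[reducible] noncomputable def rightModule (h : IsRM g r) :
    Module (NCTorus (rmTheta g r))ᵐᵒᵖ (SchwartzMod (rmOrder g)) where
  smul a f := (rightPair g r).opSum (unop a).toRapid f
  one_smul f := (rightPair g r).opSum_one _ (fun n => NCTorus.coeff_one n) f
  mul_smul a b f := (rightPair g r).opSum_mul_right (kappa_right h) (unop b) (unop a) f
  smul_zero _ := (rightPair g r).opSum_zero _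
  smul_add _ := (rightPair g r).opSum_add _
  add_smul _ _ f := (rightPair g r).add_opSum _ _ f
  zero_smul f := (rightPair g r).zero_opSum f

/-- The left `A_θ`-module structure of `E_g(θ)`:
`a f = ∑ a_{n₁,n₂} U₁^{n₁} (U₂^{n₂} f) = ∑ exp (2 π i θ n₁ n₂) a_{n₁,n₂} U₂^{n₂} (U₁^{n₁} f)`. -/
@[reducible] noncomputable def leftModule (h : IsRM g r) :
    Module (NCTorus (rmTheta g r)) (SchwartzMod (rmOrder g)) where
  smul a f := (leftPair g r).opSum a.reorder f
  one_smul f := (leftPair g r).opSum_one _ (fun n => by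
    rw [NCTorus.coeff_reorder, NCTorus.coeff_one]
    split_ifs with hn
    · simp [hn, ex_zero]
    · rw [mul_zero]) f
  mul_smul a b f := (leftPair g r).opSum_mul_left (kappa_left h) a b f
  smul_zero a := (leftPair g r).opSum_zero _
  smul_add a := (leftPair g r).opSum_add _
  add_smul a b f := by
    have e : (a + b).reorder = a.reorder + b.reorder := Subtype.ext (funext fun n => mul_add _ _ _)
    change (leftPair g r).opSum (a + b).reorder f = _
    rw [e]
    exact (leftPair g r).add_opSum _ _ f
  zero_smul f := by
    have e : (0 : NCTorus (rmTheta g r)).reorder = 0 := Subtype.ext (funext fun n => mul_zero _)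
    change (leftPair g r).opSum (0 : NCTorus (rmTheta g r)).reorder f = 0
    rw [e]
    exact (leftPair g r).zero_opSum f

/-- The standard holomorphic structure on `E_g(θ)`:
`(∇ f)(x, α) = ∂f/∂x (x, α) + 2 π i τ (c / r) x f(x, α)`, where `r = c θ + d`. -/
noncomputable def stdNabla (g : SpecialLinearGroup (Fin 2) ℤ) (r : ℝ) (τ : ℂ) :
    SchwartzMod (rmOrder g) →ₗ[ℂ] SchwartzMod (rmOrder g) :=
  conn (τ * ((g.1 1 0 : ℝ) / r : ℝ))

theorem stdNabla_right (h : IsRM g r) (τ : ℂ) (a : NCTorus (rmTheta g r))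
    (f : SchwartzMod (rmOrder g)) :
    stdNabla g r τ ((rightPair g r).opSum a.toRapid f) =
      (rightPair g r).opSum a.toRapid (stdNabla g r τ f) +
        (rightPair g r).opSum (NCTorus.delta _ τ a).toRapid f := by
  refine WeylPair.conn_opSum _ _ _ _ (fun n => ?_) f
  have hc : (g.1 1 0 : ℂ) ≠ 0 := by exact_mod_cast h.c_pos.ne'
  have hr : (r : ℂ) ≠ 0 := by exact_mod_cast h.r_pos.ne'
  rw [NCTorus.coeff_toRapid, NCTorus.coeff_toRapid, NCTorus.coeff_delta, NCTorus.deltaSymbol]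
  simp only [rightPair]
  push_cast
  field_simp
  ring

theorem stdNabla_left (h : IsRM g r) (τ : ℂ) (a : NCTorus (rmTheta g r))
    (f : SchwartzMod (rmOrder g)) :
    stdNabla g r τ ((leftPair g r).opSum a.reorder f) =
      (leftPair g r).opSum a.reorder (stdNabla g r τ f) +
        (r : ℂ)⁻¹ • (leftPair g r).opSum (NCTorus.delta _ τ a).reorder f := by
  rw [← WeylPair.smul_opSum]
  refine WeylPair.conn_opSum _ _ _ _ (fun n => ?_) f
  have hc : (g.1 1 0 : ℂ) ≠ 0 := by exact_mod_cast h.c_pos.ne'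
  have hr : (r : ℂ) ≠ 0 := by exact_mod_cast h.r_pos.ne'
  change (r : ℂ)⁻¹ * (NCTorus.delta _ τ a).reorder.1 n = _
  rw [NCTorus.coeff_reorder, NCTorus.coeff_reorder, NCTorus.coeff_delta, NCTorus.deltaSymbol]
  simp only [leftPair]
  push_cast
  field_simp
  ring

end

end SchwartzMod

open SchwartzMod in
/-- The basic `A_θ`-`A_θ`-bimodule `E_g(θ)`, `θ = (r - d) / c`, of rank `c θ + d = r`, with the
standard holomorphic structure over `T_{θ,τ}`. -/
noncomputable def basicBimodule (h : IsRM g r) (τ : ℂ) :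
    HolBimodule (NCTorus (rmTheta g r)) (NCTorus.delta (rmTheta g r) τ) :=
  haveI : NeZero (rmOrder g) := h.neZero
  letI : Module (NCTorus (rmTheta g r))ᵐᵒᵖ (SchwartzMod (rmOrder g)) := rightModule h
  letI : Module (NCTorus (rmTheta g r)) (SchwartzMod (rmOrder g)) := leftModule h
  { carrier := SchwartzMod (rmOrder g)
    tower := ⟨fun z a f => (rightPair g r).smul_opSum z (unop a).toRapid f⟩
    nabla := stdNabla g r τ
    leibniz := fun f a => stdNabla_right h τ a f
    towerL := ⟨fun z a f => by
      have e : (z • a).reorder = z • a.reorder :=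
        Subtype.ext (funext fun n => mul_left_comm _ _ _)
      change (leftPair g r).opSum (z • a).reorder f = z • (leftPair g r).opSum a.reorder f
      rw [e, WeylPair.smul_opSum]⟩
    comm := ⟨fun a b f => WeylPair.opSum_comm (leftPair g r) (rightPair g r)
      (kappa_right_left h) (kappa_left_right h) a.reorder (unop b).toRapid f⟩
    rk := r
    leibniz_left := fun a f => stdNabla_left h τ a f }

/-- The graded algebra `B_{g,r}(τ) = ⨁_{n ≥ 0} H⁰(T_{θ,τ}, E^{⊗ n})`, where `θ = (r - d) / c` and
`E = E_g(θ)` has its standard holomorphic structure. -/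
abbrev coordAlg (h : IsRM g r) (τ : ℂ) : Type :=
  (basicBimodule h τ).coordAlgebra (NCTorus.delta_isDeriv (rmTheta g r) τ)

/-- The homogeneous component of degree `n` of `B_{g,r}(τ)`. -/
noncomputable def coordAlgDegree (h : IsRM g r) (τ : ℂ) (n : ℕ) : Submodule ℂ (coordAlg h τ) :=
  LinearMap.range (DirectSum.lof ℂ ℕ
    ((basicBimodule h τ).piece (NCTorus.delta_isDeriv (rmTheta g r) τ)) n)

end RealMultiplication

/-! ### Reversal of tensor powers -/

section Reversal

open TensorProduct MulOpposite

namespace HolBimodule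

variable {A : Type} [Ring A] [Algebra ℂ A] {δ : A →ₗ[ℂ] A} (E : HolBimodule A δ) (hδ : IsDeriv δ)

/-! The isomorphism is reversal of tensors. Since `r + r⁻¹ = a + d`, the number attached to `g'` and
`r⁻¹` is `-θ`, and `A_{-θ}` is the opposite algebra of `A_θ` through `U₁ ↦ U₁`, `U₂ ↦ U₂`.
Exchanging the two actions on `E = E_g(θ)` therefore gives an `A_{-θ}`-bimodule, and the dilation
`(φ f)(x, α) = f(r x, a α)` identifies it with `F = E_{g'}(-θ)`: the dilation by `r` matches the
translations and frequencies in `x`, and multiplication by `a`, whose inverse modulo `c` is `d`,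
matches those in `α` (`swapMap_right`, `swapMap_left`). By the chain rule `φ` carries the
holomorphic structure of `E` to `r⁻¹` times that of `F` (`swapMap_nabla`). `AntiEquiv` records
exactly these properties, and everything else is deduced from them for arbitrary bimodules.

Given such a `φ`, the map `e₁ ⊗ ⋯ ⊗ eₙ ↦ φ(eₙ) ⊗ ⋯ ⊗ φ(e₁)` respects the balancing relations because
`φ` exchanges left and right, and it reverses products (`homog_reverse_mulLeft`). It also preserves
kernels. In `∇` on `E^{⊗ n}` the term differentiating `eᵢ` has weight `r^{-(n-i)}`. After reversal
`φ(eᵢ)` is in place `n + 1 - i`, where the structure of `F`, of rank `r⁻¹`, gives weight `r^{i-1}`.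
With the factor `r⁻¹` from `φ`, all terms differ by the same scalar `r^{-n}` (`reverse_nabla`), so
holomorphic vectors go to holomorphic vectors. The inverse is the reversal built from `φ⁻¹`
(`symm_reverse_reverse`).

Tensor powers grow on the right, while reversal adds factors on the left, so degrees such as `m + n`
and `n + m` must be identified throughout. Identities are therefore proved in the monoid `TotalPow`
of tensors of all degrees, where no transport appears. -/

theorem castPow_smul {m n : ℕ} (h : m = n) (z : ℂ) (x : (E.pow hδ m).carrier) :
    E.castPow hδ h (z • x) = z • E.castPow hδ h x := by
  subst h; rfl

theorem nabla_castPow {m n : ℕ} (h : m = n) (x : (E.pow hδ m).carrier) :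
    (E.pow hδ n).nabla (E.castPow hδ h x) = E.castPow hδ h ((E.pow hδ m).nabla x) := by
  subst h; rfl

theorem snoc_add_right {n : ℕ} (y : (E.pow hδ n).carrier) (e e' : E.carrier) :
    E.snoc hδ y (e + e') = E.snoc hδ y e + E.snoc hδ y e' := TensorOver.tmul_add _ _ _

theorem snoc_smul_right {n : ℕ} (z : ℂ) (y : (E.pow hδ n).carrier) (e : E.carrier) :
    E.snoc hδ y (z • e) = z • E.snoc hδ y e := TensorOver.tmul_smul _ _ _

theorem snoc_zero_left {n : ℕ} (e : E.carrier) :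
    E.snoc hδ (0 : (E.pow hδ n).carrier) e = 0 := TensorOver.zero_tmul _

theorem op_smul_snoc {n : ℕ} (a : A) (y : (E.pow hδ n).carrier) (e : E.carrier) :
    op a • E.snoc hδ y e = E.snoc hδ y (op a • e) := TensorOver.op_smul_tmul _ _ _

theorem snoc_balanced {n : ℕ} (a : A) (y : (E.pow hδ n).carrier) (e : E.carrier) :
    E.snoc hδ (op a • y) e = E.snoc hδ y (a • e) := TensorOver.tmul_balanced _ _ _

/-- A `ℂ`-bilinear map `f` with `f (y a) e = f y (a e)` factors through `E^{⊗ (n + 1)}`. -/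
noncomputable def liftPow {n : ℕ} {V : Type} [AddCommGroup V] [Module ℂ V]
    (f : (E.pow hδ n).carrier →ₗ[ℂ] E.carrier →ₗ[ℂ] V)
    (h : ∀ (y : (E.pow hδ n).carrier) (a : A) (e : E.carrier), f (op a • y) e = f y (a • e)) :
    (E.pow hδ (n + 1)).carrier →ₗ[ℂ] V :=
  TensorOver.lift f h

theorem liftPow_snoc {n : ℕ} {V : Type} [AddCommGroup V] [Module ℂ V]
    (f : (E.pow hδ n).carrier →ₗ[ℂ] E.carrier →ₗ[ℂ] V)
    (h : ∀ (y : (E.pow hδ n).carrier) (a : A) (e : E.carrier), f (op a • y) e = f y (a • e))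
    (y : (E.pow hδ n).carrier) (e : E.carrier) : E.liftPow hδ f h (E.snoc hδ y e) = f y e :=
  TensorOver.lift_tmul f h y e

/-! ### The monoid of tensors of all degrees. -/

/-- Elements of tensor powers of `E` of arbitrary degree. -/
def TotalPow : Type := Σ n, (E.pow hδ n).carrier

/-- An element of `E^{⊗ n}` as an element of the union of all tensor powers. -/
def homog {n : ℕ} (x : (E.pow hδ n).carrier) : E.TotalPow hδ := ⟨n, x⟩

/-- Nothing is lost within one degree. This is what brings identities proved in the monoid back to
`E^{⊗ n}`. -/
theorem homog_injective {n : ℕ} : Function.Injective (E.homog hδ (n := n)) := fun _ _ h =>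
  eq_of_heq (Sigma.mk.inj h).2

theorem homog_castPow {m n : ℕ} (h : m = n) (x : (E.pow hδ m).carrier) :
    E.homog hδ (E.castPow hδ h x) = E.homog hδ x := by
  subst h; rfl

/-- The tensor product of elements of tensor powers of `E`. -/
noncomputable instance : Mul (E.TotalPow hδ) := ⟨fun x y => E.homog hδ (E.mulLeft hδ x.2 y.1 y.2)⟩

noncomputable instance : Monoid (E.TotalPow hδ) where
  one := E.homog hδ (E.powOne hδ)
  mul_assoc x y w := by
    refine (E.homog_castPow hδ (add_assoc x.1 y.1 w.1) _).symm.trans ?_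
    exact congrArg (E.homog hδ) (E.mulLeft_assoc hδ x.2 y.2 w.2)
  one_mul y := by
    refine (E.homog_castPow hδ (zero_add y.1) _).symm.trans ?_
    exact congrArg (E.homog hδ) (E.powOne_mulLeft hδ y.2)
  mul_one x := congrArg (E.homog hδ) (E.mulLeft_powOne hδ x.2)

theorem homog_mulLeft {m n : ℕ} (x : (E.pow hδ m).carrier) (y : (E.pow hδ n).carrier) :
    E.homog hδ (E.mulLeft hδ x n y) = E.homog hδ x * E.homog hδ y := rfl

theorem homog_powOne : E.homog hδ (E.powOne hδ) = 1 := rfl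

/-- An element of `A` as an element of `E^{⊗ 0}`. -/
def scalar (a : A) : (E.pow hδ 0).carrier := a

theorem homog_mul_scalar {n : ℕ} (x : (E.pow hδ n).carrier) (a : A) :
    E.homog hδ x * E.homog hδ (E.scalar hδ a) = E.homog hδ (op a • x) := rfl

/-- An element of `E` as an element of `E^{⊗ 1}`. -/
noncomputable def single (e : E.carrier) : (E.pow hδ 1).carrier := E.snoc hδ (E.powOne hδ) e

/-- Every pure tensor becomes a product of degree-one elements, so the manipulations of tensors
below reduce to associativity in the monoid. -/
theorem homog_mul_single {n : ℕ} (x : (E.pow hδ n).carrier) (e : E.carrier) :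
    E.homog hδ x * E.homog hδ (E.single hδ e) = E.homog hδ (E.snoc hδ x e) := by
  rw [← homog_mulLeft, single, mulLeft_snoc, mulLeft_powOne]

/-- Balancing gives `1 ⊗ a e = a ⊗ e`. No left `A`-module structure is put on the tensor powers;
multiplication by an element of degree 0 takes its place. -/
theorem homog_scalar_mul_single (a : A) (e : E.carrier) :
    E.homog hδ (E.scalar hδ a) * E.homog hδ (E.single hδ e) = E.homog hδ (E.single hδ (a • e)) := by
  rw [homog_mul_single, single, ← snoc_balanced]
  congr 2
  exact (one_mul a).symm

theorem homog_single_mul_scalar (e : E.carrier) (a : A) :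
    E.homog hδ (E.single hδ e) * E.homog hδ (E.scalar hδ a) =
      E.homog hδ (E.single hδ (op a • e)) := by
  rw [homog_mul_scalar, single, op_smul_snoc, single]

theorem nabla_single (e : E.carrier) :
    (E.pow hδ 1).nabla (E.single hδ e) = E.single hδ (E.nabla e) := by
  have h : (E.pow hδ 0).nabla (E.powOne hδ) = 0 := E.one_mem hδ
  rw [single, nabla_snoc, h, snoc_zero_left, smul_zero, zero_add, single]

/-! ### Adding a factor on the left. -/

/-- The tensor product `e ⊗ y ∈ E^{⊗ (n + 1)}` of `e ∈ E` and `y ∈ E^{⊗ n}`. -/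
noncomputable def cons (n : ℕ) :
    E.carrier →ₗ[ℂ] (E.pow hδ n).carrier →ₗ[ℂ] (E.pow hδ (n + 1)).carrier :=
  LinearMap.mk₂ ℂ (fun e y => E.castPow hδ (add_comm 1 n) (E.mulLeft hδ (E.single hδ e) n y))
    (fun e e' y => by rw [single, snoc_add_right, mulLeft_add, castPow_add]; rfl)
    (fun z e y => by rw [single, snoc_smul_right, mulLeft_smul, castPow_smul]; rfl)
    (fun e y y' => by rw [map_add, castPow_add])
    (fun z e y => by rw [mulLeft_smul_right, castPow_smul])

theorem cons_apply {n : ℕ} (e : E.carrier) (y : (E.pow hδ n).carrier) :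
    E.cons hδ n e y = E.castPow hδ (add_comm 1 n) (E.mulLeft hδ (E.single hδ e) n y) := rfl

theorem homog_cons {n : ℕ} (e : E.carrier) (y : (E.pow hδ n).carrier) :
    E.homog hδ (E.cons hδ n e y) = E.homog hδ (E.single hδ e) * E.homog hδ y := by
  rw [cons_apply, homog_castPow, homog_mulLeft]

/-- Differentiating the leftmost factor costs one factor `rk⁻¹` for each of the `n` factors to its
right. A single element has no such cost, since `δ 1 = 0` kills the term of the leading `1` in `1 ⊗
e`. -/
theorem nabla_cons {n : ℕ} (e : E.carrier) (y : (E.pow hδ n).carrier) :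
    (E.pow hδ (n + 1)).nabla (E.cons hδ n e y) =
      (E.rk : ℂ)⁻¹ ^ n • E.cons hδ n (E.nabla e) y + E.cons hδ n e ((E.pow hδ n).nabla y) := by
  rw [cons_apply, nabla_castPow, nabla_mulLeft, castPow_add, castPow_smul, nabla_single]
  rfl

end HolBimodule

/-- An equivalence of a bimodule `E` over `A` with a bimodule `F` over the opposite algebra `B` of
`A`, which exchanges the left and right actions and rescales the holomorphic structure. -/
structure AntiEquiv {A B : Type} [Ring A] [Algebra ℂ A] [Ring B] [Algebra ℂ B] {δ : A →ₗ[ℂ] A}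
    {ε : B →ₗ[ℂ] B} (E : HolBimodule A δ) (F : HolBimodule B ε) where
  σ : A ≃ₗ[ℂ] B
  σ_mul : ∀ a b, σ (a * b) = σ b * σ a
  σ_deriv : ∀ a, σ (δ a) = ε (σ a)
  φ : E.carrier ≃ₗ[ℂ] F.carrier
  φ_op_smul : ∀ (a : A) e, φ (op a • e) = σ a • φ e
  φ_smul : ∀ (a : A) e, φ (a • e) = op (σ a) • φ e
  rk_mul_rk : (E.rk : ℂ) * F.rk = 1
  φ_nabla : ∀ e, φ (E.nabla e) = (E.rk : ℂ)⁻¹ • F.nabla (φ e)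

/-! ### Formal properties of anti-equivalences. -/

namespace AntiEquiv

open HolBimodule

variable {A B : Type} [Ring A] [Algebra ℂ A] [Ring B] [Algebra ℂ B] {δ : A →ₗ[ℂ] A}
  {ε : B →ₗ[ℂ] B} {E : HolBimodule A δ} {F : HolBimodule B ε} (Φ : AntiEquiv E F)

/-- Unitality need not be assumed: if `σ a = 1`, then `1 = σ (a * 1) = σ 1 * 1`. -/
theorem σ_one : Φ.σ 1 = 1 := by
  obtain ⟨a, ha⟩ := Φ.σ.surjective 1
  have h := Φ.σ_mul a 1
  rwa [mul_one, ha, mul_one, eq_comm] at h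

theorem rk_ne_zero (Φ : AntiEquiv E F) : (E.rk : ℂ) ≠ 0 := left_ne_zero_of_mul_eq_one Φ.rk_mul_rk

theorem rk_inv (Φ : AntiEquiv E F) : (F.rk : ℂ)⁻¹ = E.rk :=
  inv_eq_of_mul_eq_one_left Φ.rk_mul_rk

/-- The inverse equivalence. -/
def symm : AntiEquiv F E where
  σ := Φ.σ.symm
  σ_mul a b := Φ.σ.injective (by simp [Φ.σ_mul])
  σ_deriv a := Φ.σ.injective (by simp [Φ.σ_deriv])
  φ := Φ.φ.symm
  φ_op_smul a e := Φ.φ.injective (by simp [Φ.φ_smul])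
  φ_smul a e := Φ.φ.injective (by simp [Φ.φ_op_smul])
  rk_mul_rk := by rw [mul_comm, Φ.rk_mul_rk]
  φ_nabla e := Φ.φ.injective (by
    change Φ.φ (Φ.φ.symm (F.nabla e)) = Φ.φ ((F.rk : ℂ)⁻¹ • E.nabla (Φ.φ.symm e))
    rw [map_smul, Φ.φ_nabla, Φ.rk_inv, smul_smul, mul_inv_cancel₀ Φ.rk_ne_zero, one_smul]
    simp)

/-! ### The reversal map and its compatibilities. -/

variable (hδ : IsDeriv δ) (hε : IsDeriv ε)

/-- Here `T` plays the reversal in degree `n`, and `hT` says that it turns right multiplication by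
`a` into left multiplication by `σ a`. Both sides equal `φ(e) ⊗ σ(a) T(y) = φ(e) σ(a) ⊗ T(y)`, which
in the monoid is associativity. -/
theorem cons_balanced {n : ℕ} (T : (E.pow hδ n).carrier →ₗ[ℂ] (F.pow hε n).carrier)
    (hT : ∀ y (a : A),
      F.homog hε (T (op a • y)) = F.homog hε (F.scalar hε (Φ.σ a)) * F.homog hε (T y))
    (y : (E.pow hδ n).carrier) (a : A) (e : E.carrier) :
    ((F.cons hε n).compl₁₂ Φ.φ.toLinearMap T).flip (op a • y) e =
      ((F.cons hε n).compl₁₂ Φ.φ.toLinearMap T).flip y (a • e) := by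
  change F.cons hε n (Φ.φ e) (T (op a • y)) = F.cons hε n (Φ.φ (a • e)) (T y)
  refine F.homog_injective hε ?_
  rw [homog_cons, homog_cons, hT, Φ.φ_smul, ← homog_single_mul_scalar, mul_assoc]

/-- The property `hT` passes to degree `n + 1`, which lets the recursion continue: on `y ⊗ e` the
right action touches only `e`, and `φ(e a) = σ(a) φ(e)` becomes the leftmost factor. -/
theorem liftPow_cons_op_smul {n : ℕ} (T : (E.pow hδ n).carrier →ₗ[ℂ] (F.pow hε n).carrier)
    (hT : ∀ y (a : A),
      F.homog hε (T (op a • y)) = F.homog hε (F.scalar hε (Φ.σ a)) * F.homog hε (T y))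
    (y : (E.pow hδ (n + 1)).carrier) (a : A) :
    F.homog hε (E.liftPow hδ _ (Φ.cons_balanced hδ hε T hT) (op a • y)) =
      F.homog hε (F.scalar hε (Φ.σ a)) *
        F.homog hε (E.liftPow hδ _ (Φ.cons_balanced hδ hε T hT) y) := by
  set L := E.liftPow hδ _ (Φ.cons_balanced hδ hε T hT)
  have hL : ∀ y e, F.homog hε (L (E.snoc hδ y e)) =
      F.homog hε (F.single hε (Φ.φ e)) * F.homog hε (T y) := fun y e => by
    rw [← homog_cons]
    exact congrArg _ (E.liftPow_snoc hδ _ _ y e)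
  -- The union of the tensor powers has no addition. For the additive steps of the induction the
  -- identity is rewritten inside a single degree, where both sides are additive.
  have key : ∀ z w : (F.pow hε (n + 1)).carrier,
      F.homog hε z = F.homog hε (F.scalar hε (Φ.σ a)) * F.homog hε w ↔
        z = F.castPow hε (zero_add (n + 1))
          (F.mulLeft hε (F.scalar hε (Φ.σ a)) (n + 1) w) := fun z w => by
    rw [← (F.homog_injective hε).eq_iff, homog_castPow, homog_mulLeft]
  induction y using pow_induction with
  | h0 => rw [key, smul_zero, map_zero, map_zero, castPow_zero]
  | ht y e =>
    rw [op_smul_snoc, hL, hL, Φ.φ_op_smul, ← homog_scalar_mul_single, mul_assoc]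
  | ha x y hx hy =>
    rw [key] at hx hy ⊢
    rw [smul_add, map_add, hx, hy, map_add, map_add, castPow_add]

/-- The reversal `e₁ ⊗ ⋯ ⊗ eₙ ↦ φ(eₙ) ⊗ ⋯ ⊗ φ(e₁)`, together with its compatibility with right
multiplication. -/
noncomputable def reverseAux : (n : ℕ) →
    {T : (E.pow hδ n).carrier →ₗ[ℂ] (F.pow hε n).carrier //
      ∀ y (a : A), F.homog hε (T (op a • y)) = F.homog hε (F.scalar hε (Φ.σ a)) * F.homog hε (T y)}
  | 0 => ⟨Φ.σ.toLinearMap, fun y a => congrArg (F.homog hε (n := 0)) (Φ.σ_mul y a)⟩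
  | n + 1 => ⟨E.liftPow hδ _ (Φ.cons_balanced hδ hε (reverseAux n).1 (reverseAux n).2),
      Φ.liftPow_cons_op_smul hδ hε (reverseAux n).1 (reverseAux n).2⟩

/-- The reversal `E^{⊗ n} → F^{⊗ n}`, `e₁ ⊗ ⋯ ⊗ eₙ ↦ φ(eₙ) ⊗ ⋯ ⊗ φ(e₁)`. -/
noncomputable def reverse (n : ℕ) : (E.pow hδ n).carrier →ₗ[ℂ] (F.pow hε n).carrier :=
  (Φ.reverseAux hδ hε n).1

theorem homog_reverse_op_smul {n : ℕ} (y : (E.pow hδ n).carrier) (a : A) :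
    F.homog hε (Φ.reverse hδ hε n (op a • y)) =
      F.homog hε (F.scalar hε (Φ.σ a)) * F.homog hε (Φ.reverse hδ hε n y) :=
  (Φ.reverseAux hδ hε n).2 y a

theorem reverse_powOne : Φ.reverse hδ hε 0 (E.powOne hδ) = F.powOne hε := Φ.σ_one

theorem reverse_snoc {n : ℕ} (y : (E.pow hδ n).carrier) (e : E.carrier) :
    Φ.reverse hδ hε (n + 1) (E.snoc hδ y e) = F.cons hε n (Φ.φ e) (Φ.reverse hδ hε n y) :=
  E.liftPow_snoc hδ _ (Φ.cons_balanced hδ hε _ (Φ.reverseAux hδ hε n).2) y e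

theorem homog_reverse_snoc {n : ℕ} (y : (E.pow hδ n).carrier) (e : E.carrier) :
    F.homog hε (Φ.reverse hδ hε (n + 1) (E.snoc hδ y e)) =
      F.homog hε (F.single hε (Φ.φ e)) * F.homog hε (Φ.reverse hδ hε n y) := by
  rw [reverse_snoc, homog_cons]

theorem reverse_single (e : E.carrier) :
    Φ.reverse hδ hε 1 (E.single hδ e) = F.single hε (Φ.φ e) := by
  refine F.homog_injective hε ?_
  rw [single, homog_reverse_snoc, reverse_powOne, homog_powOne, mul_one]

/-- The induction follows the right factor, as the definition of the product does. Degree 0 is the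
compatibility with right multiplication carried along in `reverseAux`; for `y ⊗ e`, both sides begin
with `φ(e)`. -/
theorem homog_reverse_mulLeft {m n : ℕ} (x : (E.pow hδ m).carrier) (y : (E.pow hδ n).carrier) :
    F.homog hε (Φ.reverse hδ hε (m + n) (E.mulLeft hδ x n y)) =
      F.homog hε (Φ.reverse hδ hε n y) * F.homog hε (Φ.reverse hδ hε m x) := by
  induction n with
  | zero => exact Φ.homog_reverse_op_smul hδ hε x y
  | succ n ih =>
    -- As before, sums exist only in a fixed degree, so the identity is restated there for the
    -- additive step.
    have key : ∀ (z : (F.pow hε (m + (n + 1))).carrier) (w : (F.pow hε (n + 1)).carrier),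
        F.homog hε z = F.homog hε w * F.homog hε (Φ.reverse hδ hε m x) ↔
          z = F.castPow hε (add_comm (n + 1) m)
            (F.mulLeft hε w m (Φ.reverse hδ hε m x)) := fun z w => by
      rw [← (F.homog_injective hε).eq_iff, homog_castPow, homog_mulLeft]
    induction y using pow_induction with
    | h0 => rw [key, map_zero, map_zero, map_zero, mulLeft_zero_left, castPow_zero]
    | ht y e =>
      rw [mulLeft_snoc]
      refine (Φ.homog_reverse_snoc hδ hε (n := m + n) _ e).trans ?_
      rw [ih, homog_reverse_snoc, mul_assoc]
    | ha y y' hy hy' =>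
      rw [key] at hy hy' ⊢
      rw [map_add, map_add, hy, hy', map_add, mulLeft_add, castPow_add]

/-- Lets the argument of the reversal be replaced by an equal tensor whose degree is written
differently, such as `1 + n` for `n + 1`. -/
theorem homog_reverse_congr {m n : ℕ} {x : (E.pow hδ m).carrier} {y : (E.pow hδ n).carrier}
    (h : E.homog hδ x = E.homog hδ y) :
    F.homog hε (Φ.reverse hδ hε m x) = F.homog hε (Φ.reverse hδ hε n y) := by
  obtain rfl : m = n := congrArg Sigma.fst h
  rw [E.homog_injective hδ h]

theorem symm_reverse_reverse {n : ℕ} (x : (E.pow hδ n).carrier) :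
    Φ.symm.reverse hε hδ n (Φ.reverse hδ hε n x) = x := by
  induction n with
  | zero => exact Φ.σ.symm_apply_apply x
  | succ n ih =>
    induction x using pow_induction with
    | h0 => rw [map_zero, map_zero]
    | ht y e =>
      refine E.homog_injective hδ ?_
      -- The first reversal puts `φ(e)` on the left. Seen as a product of a single element and a
      -- tensor of degree `n`, the result can be reversed again by antimultiplicativity, which
      -- returns `e` to the right end.
      have h : F.homog hε (Φ.reverse hδ hε (n + 1) (E.snoc hδ y e)) =
          F.homog hε (F.mulLeft hε (F.single hε (Φ.φ e)) n (Φ.reverse hδ hε n y)) := by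
        rw [homog_reverse_snoc, homog_mulLeft]
      rw [Φ.symm.homog_reverse_congr hε hδ h, homog_reverse_mulLeft, ih, reverse_single,
        homog_mul_single]
      congr 2
      exact Φ.φ.symm_apply_apply e
    | ha x y hx hy => rw [map_add, map_add, hx, hy]

/-- The two holomorphic structures weight the factors from opposite ends, with inverse ranks. The
quotient of the weights is hence independent of the position, and one scalar serves for all terms.
-/
theorem reverse_nabla {n : ℕ} (x : (E.pow hδ n).carrier) :
    Φ.reverse hδ hε n ((E.pow hδ n).nabla x) =
      (E.rk : ℂ)⁻¹ ^ n • (F.pow hε n).nabla (Φ.reverse hδ hε n x) := by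
  -- Compares the terms in which the last factor `e` is differentiated: `φ_nabla` contributes
  -- `rk⁻¹`, and `nabla_cons` for `F` contributes `F.rk⁻¹ ^ n`, which is `E.rk ^ n`.
  have hc (n : ℕ) : (E.rk : ℂ)⁻¹ ^ (n + 1) * (F.rk : ℂ)⁻¹ ^ n = (E.rk : ℂ)⁻¹ := by
    rw [Φ.rk_inv, pow_succ, mul_right_comm, ← mul_pow, inv_mul_cancel₀ Φ.rk_ne_zero, one_pow,
      one_mul]
  induction n with
  | zero => exact (Φ.σ_deriv x).trans (by rw [pow_zero, one_smul]; rfl)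
  | succ n ih =>
    induction x using pow_induction with
    | h0 => simp only [map_zero, smul_zero]
    | ht y e =>
      rw [nabla_snoc, map_add, map_smul, reverse_snoc, reverse_snoc, reverse_snoc, nabla_cons, ih,
        Φ.φ_nabla, map_smul, map_smul, LinearMap.smul_apply, smul_add, smul_smul, smul_smul,
        ← pow_succ', hc]
      exact add_comm _ _
    | ha x y hx hy => rw [map_add, map_add, hx, hy, map_add, map_add, smul_add]

/-! ### Passage to the homogeneous coordinate algebras. -/

/-- The reversal of holomorphic vectors. -/
noncomputable def reversePiece (n : ℕ) : E.piece hδ n →ₗ[ℂ] F.piece hε n :=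
  (Φ.reverse hδ hε n).restrict (p := (E.pow hδ n).H0) (q := (F.pow hε n).H0) (fun x hx => by
    have hx' : (E.pow hδ n).nabla x = 0 := hx
    have h := Φ.reverse_nabla hδ hε x
    rw [hx', map_zero, eq_comm] at h
    -- The reversal commutes with the holomorphic structures only up to a scalar; since the scalar
    -- is nonzero, the kernel is preserved.
    exact (smul_eq_zero_iff_right (pow_ne_zero n (inv_ne_zero Φ.rk_ne_zero))).1 h)

/-- The two sides have degrees `m + n` and `n + m`, hence the statement in the graded monoid, which
is also the form that equality of homogeneous components in the direct sum requires. -/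
theorem mk_reversePiece_mul {m n : ℕ} (x : E.piece hδ m) (y : E.piece hδ n) :
    (GradedMonoid.mk (m + n) (Φ.reversePiece hδ hε (m + n) (GradedMonoid.GMul.mul x y)) :
      GradedMonoid (F.piece hε)) =
      GradedMonoid.mk (n + m)
        (GradedMonoid.GMul.mul (Φ.reversePiece hδ hε n y) (Φ.reversePiece hδ hε m x)) := by
  refine F.mk_eq hε (add_comm m n) (F.homog_injective hε ?_)
  rw [homog_castPow]
  exact Φ.homog_reverse_mulLeft hδ hε x.1 y.1

/-- The reversal of tensors as a homomorphism into the opposite algebra. -/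
noncomputable def reverseHom : E.coordAlgebra hδ →ₐ[ℂ] (F.coordAlgebra hε)ᵐᵒᵖ :=
  DirectSum.toAlgebra ℂ (E.piece hδ)
    (fun n => (opLinearEquiv ℂ).toLinearMap ∘ₗ DirectSum.lof ℂ ℕ (F.piece hε) n ∘ₗ
      Φ.reversePiece hδ hε n)
    (congrArg (fun x => op (DirectSum.of (F.piece hε) 0 x))
      (Subtype.ext (Φ.reverse_powOne hδ hε)))
    (fun {m n} x y => by
      refine congrArg op (((DirectSum.of_eq_of_gradedMonoid_eq
        (Φ.mk_reversePiece_mul hδ hε x y))).trans ?_)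
      exact (DirectSum.of_mul_of _ _).symm)

theorem reverseHom_lof (n : ℕ) (x : E.piece hδ n) :
    Φ.reverseHom hδ hε (DirectSum.lof ℂ ℕ (E.piece hδ) n x) =
      op (DirectSum.lof ℂ ℕ (F.piece hε) n (Φ.reversePiece hδ hε n x)) :=
  DirectSum.toModule_lof (φ := fun n => (opLinearEquiv ℂ).toLinearMap ∘ₗ
    DirectSum.lof ℂ ℕ (F.piece hε) n ∘ₗ Φ.reversePiece hδ hε n) ℂ n x

theorem symm_reverseHom_reverseHom (x : E.coordAlgebra hδ) :
    (Φ.symm.reverseHom hε hδ (Φ.reverseHom hδ hε x).unop).unop = x := by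
  induction x using DirectSum.induction_on with
  | zero => simp
  | of n x =>
    change (Φ.symm.reverseHom hε hδ (Φ.reverseHom hδ hε
      (DirectSum.lof ℂ ℕ (E.piece hδ) n x)).unop).unop = DirectSum.lof ℂ ℕ (E.piece hδ) n x
    rw [reverseHom_lof, unop_op, reverseHom_lof, unop_op]
    exact congrArg _ (Subtype.ext (Φ.symm_reverse_reverse hδ hε x.1))
  | add x y hx hy => simp only [map_add, unop_add, hx, hy]

/-- The reversal of tensors as an isomorphism of homogeneous coordinate algebras. -/
noncomputable def reverseEquiv : (E.coordAlgebra hδ)ᵐᵒᵖ ≃ₐ[ℂ] F.coordAlgebra hε where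
  toFun x := (Φ.reverseHom hδ hε x.unop).unop
  invFun y := Φ.symm.reverseHom hε hδ y
  left_inv x := unop_injective (Φ.symm_reverseHom_reverseHom hδ hε x.unop)
  -- The same statement as for the left inverse, applied to `Φ.symm`, whose own inverse is `Φ` by
  -- definition.
  right_inv y := Φ.symm.symm_reverseHom_reverseHom hε hδ y
  map_mul' x y := by rw [unop_mul, map_mul, unop_mul]
  map_add' x y := by rw [unop_add, map_add, unop_add]
  commutes' z := by
    change (Φ.reverseHom hδ hε (algebraMap ℂ _ z)).unop = _
    rw [AlgHom.commutes]; rfl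

theorem reverseEquiv_op_mem {n : ℕ} {x : E.coordAlgebra hδ}
    (hx : x ∈ LinearMap.range (DirectSum.lof ℂ ℕ (E.piece hδ) n)) :
    Φ.reverseEquiv hδ hε (op x) ∈ LinearMap.range (DirectSum.lof ℂ ℕ (F.piece hε) n) := by
  obtain ⟨x, rfl⟩ := hx
  exact ⟨Φ.reversePiece hδ hε n x, (congrArg unop (Φ.reverseHom_lof hδ hε n x)).symm⟩

/-- Reversal preserves degrees, and so does its inverse, which is again a reversal; this gives both
directions. -/
theorem mem_iff_reverseEquiv_op_mem (n : ℕ) (x : E.coordAlgebra hδ) :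
    x ∈ LinearMap.range (DirectSum.lof ℂ ℕ (E.piece hδ) n) ↔
      Φ.reverseEquiv hδ hε (op x) ∈ LinearMap.range (DirectSum.lof ℂ ℕ (F.piece hε) n) := by
  refine ⟨Φ.reverseEquiv_op_mem hδ hε, fun h => ?_⟩
  have h' := Φ.symm.reverseEquiv_op_mem hε hδ h
  rwa [show Φ.symm.reverseEquiv hε hδ (op (Φ.reverseEquiv hδ hε (op x))) = x from
    Φ.symm_reverseHom_reverseHom hδ hε x] at h'

end AntiEquiv

end Reversal
/-! ### The anti-equivalence of `E_g(θ)` and `E_{g'}(-θ)` -/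

section Dilation

open Complex
open scoped SchwartzMap

/-! ### The opposite algebra of a noncommutative torus. -/

namespace NCTorus

/-- The anti-isomorphism `A_θ → A_{-θ}` with `U₁ ↦ U₁`, `U₂ ↦ U₂`. -/
noncomputable def antiIso {θ θ' : ℝ} (h : θ' = -θ) : NCTorus θ ≃ₗ[ℂ] NCTorus θ' where
  toFun a := ofCoeff a.reorder.1 a.reorder.2
  invFun b := ofCoeff b.reorder.1 b.reorder.2
  map_add' a b := ext fun _ => mul_add _ _ _
  map_smul' z a := ext fun _ => mul_left_comm _ _ _
  left_inv a := ext fun n => by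
    change ex (θ' * n.1 * n.2) * (ex (θ * n.1 * n.2) * a.coeff n) = a.coeff n
    rw [← mul_assoc, ← ex_add, h, show -θ * n.1 * n.2 + θ * n.1 * n.2 = 0 by ring, ex_zero, one_mul]
  right_inv a := ext fun n => by
    change ex (θ * n.1 * n.2) * (ex (θ' * n.1 * n.2) * a.coeff n) = a.coeff n
    rw [← mul_assoc, ← ex_add, h, show θ * n.1 * n.2 + -θ * n.1 * n.2 = 0 by ring, ex_zero, one_mul]

variable {θ θ' : ℝ} (h : θ' = -θ)

theorem coeff_antiIso (a : NCTorus θ) (n : ℤ × ℤ) :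
    (antiIso h a).coeff n = ex (θ * n.1 * n.2) * a.coeff n := rfl

/-- An anti-isomorphism fixing the generators turns `U₁^{n₁} U₂^{n₂}` into `U₂^{n₂} U₁^{n₁}`, so the
coefficients of the image in the opposite order are the original ones. As the left action is defined
by the reordered coefficients and the right action by the original ones, this is what makes the two
actions match. -/
theorem antiIso_reorder (a : NCTorus θ) : (antiIso h a).reorder = a.toRapid :=
  Subtype.ext (congrArg coeff ((antiIso h).symm_apply_apply a))

theorem antiIso_mul (a b : NCTorus θ) : antiIso h (a * b) = antiIso h b * antiIso h a := by
  refine ext fun n => ?_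
  -- The substitution `m ↦ n - m` interchanges the two factors of the convolution. It remains to
  -- compare the phases, which is `hc`.
  rw [coeff_antiIso, coeff_mul, coeff_mul, ← tsum_mul_left, ← (Equiv.subLeft n).tsum_eq]
  refine tsum_congr fun m => ?_
  simp only [Equiv.subLeft_apply, sub_sub_cancel, coeff_antiIso, cocycle]
  have hc : ex (θ * n.1 * n.2) * ex (-(θ * (n - m).2 * m.1)) =
      ex (θ * m.1 * m.2) * ex (θ * (n - m).1 * (n - m).2) * ex (-(θ' * m.2 * (n - m).1)) := by
    simp only [← ex_add, h, Prod.fst_sub, Prod.snd_sub]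
    congr 1; push_cast; ring
  linear_combination a.coeff (n - m) * b.coeff m * hc

/-- Both maps are diagonal on the monomials, and the symbol of `δ_τ` does not involve `θ`. -/
theorem antiIso_delta (τ : ℂ) (a : NCTorus θ) :
    antiIso h (delta θ τ a) = delta θ' τ (antiIso h a) :=
  ext fun _ => mul_left_comm _ _ _

end NCTorus

/-! ### Dilations of Schwartz functions. -/

namespace SchwartzMod

variable {N : ℕ}

/-- The dilation `f ↦ ((x, α) ↦ f(t x, u α))`. -/
noncomputable def dilate (t : ℝˣ) (u : (ZMod N)ˣ) : SchwartzMod N ≃ₗ[ℂ] SchwartzMod N where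
  toFun f := fun α => SchwartzMap.compCLMOfContinuousLinearEquiv ℂ
    (ContinuousLinearEquiv.unitsEquivAut ℝ t) (f (u * α))
  invFun f := fun α => SchwartzMap.compCLMOfContinuousLinearEquiv ℂ
    (ContinuousLinearEquiv.unitsEquivAut ℝ t⁻¹) (f ((u⁻¹ : (ZMod N)ˣ) * α))
  map_add' f g := ext fun α x => rfl
  map_smul' z f := ext fun α x => rfl
  left_inv f := ext fun α x => by
    change f.val (u * ((u⁻¹ : (ZMod N)ˣ) * α)) (x * (t⁻¹ : ℝˣ) * t) = _
    rw [Units.mul_inv_cancel_left, Units.inv_mul_cancel_right]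
  right_inv f := ext fun α x => by
    change f.val ((u⁻¹ : (ZMod N)ˣ) * (u * α)) (x * t * (t⁻¹ : ℝˣ)) = _
    rw [Units.inv_mul_cancel_left, Units.mul_inv_cancel_right]

theorem val_dilate (t : ℝˣ) (u : (ZMod N)ˣ) (f : SchwartzMod N) (α : ZMod N) (x : ℝ) :
    (dilate t u f).val α x = f.val (u * α) (x * t) := rfl

/-- The derivative of `f(t x)` produces one factor `t`, and the multiplication operator `x` at the
point `t x` another. Normalizing the coefficient of the derivative leaves `t⁻¹` outside and `t ^ 2`
on `ν`. -/
theorem dilate_conn (t : ℝˣ) (u : (ZMod N)ˣ) (ν : ℂ) (f : SchwartzMod N) :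
    dilate t u (conn ν f) = (t : ℂ)⁻¹ • conn (ν * t ^ 2) (dilate t u f) := by
  refine ext fun α x => ?_
  have ht : (t : ℂ) ≠ 0 := by exact_mod_cast t.ne_zero
  have hd : deriv ((dilate t u f).val α) x = t * deriv (f.val (u * α)) (x * t) := by
    have h := (hasDerivAt_val f (u * α) (x * t)).scomp x ((hasDerivAt_id x).mul_const (t : ℝ))
    rw [one_mul] at h
    exact h.deriv.trans (Complex.real_smul)
  rw [val_smul, val_dilate, val_conn, val_conn, hd, val_dilate]
  push_cast
  field_simp

variable [NeZero N]

/-- A translation by `s` in the variable `t x` is one by `s / t` in `x`, and a frequency `w` becomes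
`w t`; likewise for `u` on `ℤ/N`. The coefficients are untouched, since both sums use the same order
of operators. -/
theorem dilate_opSum (t : ℝˣ) (u : (ZMod N)ˣ) (P Q : WeylPair N) (hs : Q.s * t = P.s)
    (hw : Q.w = P.w * t) (hβ : u * Q.β = P.β) (hγ : Q.γ = P.γ * u) (a : rapid)
    (f : SchwartzMod N) : dilate t u (P.opSum a f) = Q.opSum a (dilate t u f) := by
  refine ext fun α x => ?_
  rw [val_dilate, WeylPair.val_opSum, WeylPair.val_opSum]
  refine tsum_congr fun n => ?_
  rw [WeylPair.term, WeylPair.term, WeylPair.phase, WeylPair.phase, val_dilate, hw, hγ, ← hs, ← hβ]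
  congr 2
  · congr 2 <;> ring_nf
  · congr 1 <;> ring

end SchwartzMod

end Dilation

/-! ### The basic bimodules of `g` and `g'`. -/

section RealMultiplication

open Complex MulOpposite Matrix SchwartzMod

variable {g : SpecialLinearGroup (Fin 2) ℤ} {r : ℝ}

/-- Equivalent to `r + r⁻¹ = a + d`, the trace of `g`. -/
theorem rmTheta_swap (h : IsRM g r) : rmTheta (swapDiag g) r⁻¹ = -rmTheta g r := by
  have hc : (g.1 1 0 : ℝ) ≠ 0 := by exact_mod_cast h.c_pos.ne'
  have hr := h.r_pos.ne'
  have hq := h.quadratic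
  change (r⁻¹ - (g.1 0 0 : ℝ)) / (g.1 1 0 : ℝ) = -((r - g.1 1 1) / g.1 1 0)
  field_simp
  linarith

theorem entry_mul_entry_eq_one (g : SpecialLinearGroup (Fin 2) ℤ) :
    (g.1 0 0 : ZMod (rmOrder g)) * (g.1 1 1 : ZMod (rmOrder g)) = 1 := by
  have hd := g.2
  rw [Matrix.det_fin_two] at hd
  have hz : (g.1 1 0 : ZMod (rmOrder g)) = 0 :=
    (ZMod.intCast_zmod_eq_zero_iff_dvd _ _).2 (Int.natAbs_dvd.2 dvd_rfl)
  have h := congrArg (Int.cast : ℤ → ZMod (rmOrder g)) hd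
  push_cast at h
  rwa [hz, mul_zero, sub_zero] at h

/-- The residue class of the upper left entry `a` in `(ℤ/cℤ)ˣ`. -/
def entryUnit (g : SpecialLinearGroup (Fin 2) ℤ) : (ZMod (rmOrder g))ˣ :=
  Units.mkOfMulEqOne (g.1 0 0 : ZMod (rmOrder g)) (g.1 1 1) (entry_mul_entry_eq_one g)

/-- The map `(φ f)(x, α) = f(r x, a α)` from `E_g(θ)` to `E_{g'}(-θ)`. -/
noncomputable def swapMap (h : IsRM g r) : SchwartzMod (rmOrder g) ≃ₗ[ℂ] SchwartzMod (rmOrder g) :=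
  dilate (Units.mk0 r h.r_pos.ne') (entryUnit g)

/-- The frequencies `1` and `r` force the dilation factor `r`, and the shifts `1` and `d` in `ℤ/cℤ`
force the unit `a = d⁻¹`. The remaining two conditions then hold. Both index groups are `ℤ/cℤ`,
because `g` and `g'` share the entry `c`; fixing `N` makes this visible. -/
theorem swapMap_right [NeZero (rmOrder g)] (h : IsRM g r) (a : rapid)
    (f : SchwartzMod (rmOrder g)) : swapMap h ((rightPair g r).opSum a f) =
      WeylPair.opSum (N := rmOrder g) (leftPair (swapDiag g) r⁻¹) a (swapMap h f) := by
  refine dilate_opSum (N := rmOrder g) _ _ _ (leftPair (swapDiag g) r⁻¹ : WeylPair (rmOrder g)) ?_ ?_ ?_ ?_ a f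
  · change 1 / (g.1 1 0 : ℝ) * r = r / g.1 1 0
    ring
  · change 1 / r⁻¹ = 1 * r
    rw [one_div, inv_inv, one_mul]
  · exact entry_mul_entry_eq_one g
  · change (-1 : ZMod (rmOrder g)) = -(g.1 1 1 : ZMod (rmOrder g)) * (g.1 0 0 : ZMod (rmOrder g))
    rw [neg_mul, mul_comm, entry_mul_entry_eq_one]

theorem swapMap_left [NeZero (rmOrder g)] (h : IsRM g r) (a : rapid)
    (f : SchwartzMod (rmOrder g)) : swapMap h ((leftPair g r).opSum a f) =
      WeylPair.opSum (N := rmOrder g) (rightPair (swapDiag g) r⁻¹) a (swapMap h f) := by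
  have hr := h.r_pos.ne'
  refine dilate_opSum (N := rmOrder g) _ _ _ (rightPair (swapDiag g) r⁻¹ : WeylPair (rmOrder g)) ?_ ?_ ?_ ?_ a f
  · change r⁻¹ / (g.1 1 0 : ℝ) * r = 1 / g.1 1 0
    field_simp
  · change 1 = 1 / r * r
    field_simp
  · exact mul_one _
  · change -(g.1 0 0 : ZMod (rmOrder g)) = -1 * (g.1 0 0 : ZMod (rmOrder g))
    rw [neg_one_mul]

/-- Dilation by `r` turns the constant `τ c / r` into `τ c r = τ c / r⁻¹`, the one belonging to the
eigenvalue `r⁻¹` of `g'`. -/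
theorem swapMap_nabla (h : IsRM g r) (τ : ℂ) (f : SchwartzMod (rmOrder g)) :
    swapMap h (stdNabla g r τ f) =
      (r : ℂ)⁻¹ • (stdNabla (swapDiag g) r⁻¹ τ : SchwartzMod (rmOrder g) →ₗ[ℂ] _) (swapMap h f) := by
  refine (dilate_conn _ _ _ _).trans ?_
  have hr : (r : ℂ) ≠ 0 := by exact_mod_cast h.r_pos.ne'
  have e : τ * ((g.1 1 0 : ℝ) / r : ℝ) * ((Units.mk0 r h.r_pos.ne' : ℝˣ) : ℝ) ^ 2 =
      τ * (((g.1 1 0 : ℝ) / r⁻¹ : ℝ) : ℂ) := by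
    rw [Units.val_mk0]; push_cast; field_simp
  rw [e]
  rfl

/-- The bimodules `E_g(θ)` and `E_{g'}(-θ)` correspond to each other under exchange of the left and
right actions. -/
noncomputable def basicAntiEquiv (h : IsRM g r) (τ : ℂ) :
    AntiEquiv (basicBimodule h τ) (basicBimodule h.swap τ) :=
  haveI : NeZero (rmOrder g) := h.neZero
  { σ := NCTorus.antiIso (rmTheta_swap h)
    σ_mul := NCTorus.antiIso_mul _
    σ_deriv := NCTorus.antiIso_delta _ τ
    φ := swapMap h
    φ_op_smul := fun a f => by
      refine (swapMap_right h a.toRapid f).trans ?_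
      -- The left action on the target is defined by reordered coefficients; those of `σ a` are the
      -- coefficients of `a`.
      rw [← NCTorus.antiIso_reorder (rmTheta_swap h) a]
      rfl
    -- No rewriting is needed here: the coefficients of `σ a` are by definition the reordered ones
    -- of `a`.
    φ_smul := fun a f => swapMap_left h a.reorder f
    rk_mul_rk := by
      have hr : (r : ℂ) ≠ 0 := by exact_mod_cast h.r_pos.ne'
      change (r : ℂ) * ((r⁻¹ : ℝ) : ℂ) = 1
      rw [Complex.ofReal_inv, mul_inv_cancel₀ hr]
    φ_nabla := fun f => swapMap_nabla h τ f }

end RealMultiplication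

theorem mainTheorem10 (g : Matrix.SpecialLinearGroup (Fin 2) ℤ) (r : ℝ) (h : IsRM g r) (τ : ℂ)
    (hτ : τ.im < 0) :
    ∃ φ : (coordAlg h τ)ᵐᵒᵖ ≃ₐ[ℂ] coordAlg h.swap τ,
      ∀ (n : ℕ) (x : coordAlg h τ),
        x ∈ coordAlgDegree h τ n ↔ φ (MulOpposite.op x) ∈ coordAlgDegree h.swap τ n :=
  ⟨(basicAntiEquiv h τ).reverseEquiv (NCTorus.delta_isDeriv _ τ) (NCTorus.delta_isDeriv _ τ),
    (basicAntiEquiv h τ).mem_iff_reverseEquiv_op_mem _ _⟩
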